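/- **Setting.** For vectors $y_1,\dots,y_n\in\mathbb R^d$ let $\operatorname{mean}(Y)=\frac1n\sum_i y_i$ and $\operatorname{Cov}(Y)=\frac1n\sum_i (y_i-\operatorname{mean}(Y))(y_i-\operatorname{mean}(Y))^{\mathsf T}$; a *maximum-variance direction* of $Y$ is a unit eigenvector of $\operatorname{Cov}(Y)$ for its largest eigenvalue $\|\operatorname{Cov}(Y)\|_2$. $Y$ is an $\varepsilon$-corruption of $X=(x_1,\dots,x_n)$ if $y_i\ne x_i$ for at most $\varepsilon n$ indices. A *strong robust aggregator* with parameters $(\varepsilon,\tau)$ is a function $f$ of $n$ vectors in $\mathbb R^d$ and a number such that $\|f(Y,\|\operatorname{Cov}(X)\|_2)-\operatorname{mean}(X)\|_2\le \tau\sqrt{\varepsilon}\,\|\operatorname{Cov}(X)\|_2^{1/2}$ for all $X$ and all $\varepsilon$-corruptions $Y$ of $X$. (The bias factor $\tau\sqrt\varepsilon$ does not depend on $n$ and $d$.) **Elements of construction.** Let $X=(x_1,\dots,x_n)$ be i.i.d. $N(0,I_d)$, and let $(b_1,b_2)$ be a random pair of orthogonal unit vectors, of any distribution (for instance uniform), independent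 of $X$. Let $S_1,S_2\subseteq\{1,\dots,n\}$ be disjoint with $|S_1|=|S_2|=\varepsilon n/2$, and let $l_i$, $i\in S_1\cup S_2$, be real numbers with $|l_i|<\sqrt d$, $\sum_{i\in S_1}l_i=\sum_{i\in S_2}l_i=0$ and $\sum_{i\in S_1}l_i^2=\sum_{i\in S_2}l_i^2$. Let $Y'$ consist of the vectors $y_i=(\sqrt d+l_i)b_1$ for $i\in S_1$, $y_i=(\sqrt d+l_i)b_2$ for $i\in S_2$, and $y_i=x_i$ otherwise. **Reduction.** On input $Y=(y_1,\dots,y_n)$, a number $m$ of vectors to select, and the number $s$ that is handed to $f$: compute $w=\operatorname{mean}(Y)-f(Y,s)$ and the scores $\langle w,y_i/\|y_i\|\rangle$; sort the vectors by decreasing score (by merge sort) and keep the first $m$; let $c_1$ be the first of them and $c_2$ the first later one with $\langle c_1,c_2\rangle=0$ (the last one if there is none); return $c_1/\|c_1\|-c_2/\|c_2\|$. Running time is counted on a real-number machine: each arithmetic operation, square root, comparison, constant and bookkeeping step takes one unit of time, and the call of $f$ takes time $T(f)$. **Theorem.** 1. (Running time.) There are absolute constants $c,C>0$ such that for all $n,d\ge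 1$, all $m$ and all inputs the running time of the reduction is at least $T(f)+c\,nd$ and at most $T(f)+C\,nd\,(1+\log(nd))$; that is, it is $T(f)+\tilde\Theta(|Y|)$ with $|Y|=nd$. 2. (Correctness.) For every $\varepsilon\in(0,\frac12)$ there is $K>0$, and for every $\tau\ge0$ there are moreover $N\in\mathbb N$ and $c,C>0$, such that the following holds for all $n\ge N$, all $d$, all strong robust aggregators $f$ with parameters $(\varepsilon,\tau)$, all $Y'$ built as above and all $\delta>2$. With probability at least $$1-2e^{-\delta^2/2}-C\,n\,e^{-c d},$$ the reduction, run on $Y'$ with $m=\varepsilon n$ and $s=\|\operatorname{Cov}(X)\|_2$, returns $b_1-b_2$ or $b_2-b_1$, and the angle between the line spanned by the returned vector and every maximum-variance direction of $Y'$ is at most $$\cos^{-1}\!\Big(\sqrt{1-K\,\delta^2/n}\Big)$$ (where the square root of a negative number is read as $0$). -/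

import Mathlib

open MeasureTheory ProbabilityTheory

/-! ### A real-number machine with an explicit instruction count -/

/-- The arithmetic instructions. -/
inductive ArithOp where
  | add
  | sub
  | mul
  | div

/-- Programs of a real-number machine, for inputs that consist of `n` vectors with `d` entries.
The numbers live in an abstract type `R`, so a program that is polymorphic in `R` can create a
number only with `const`, `arith`, `sqrt` or `agg`, and can branch on numbers only with `le`.
`tick` is one step of bookkeeping (storing a cell of an array, moving a list cell, an iteration
of a loop), and `agg` is a call of the aggregator on `n` vectors together with a number. -/
inductive Prog (R : Type) (n d : ℕ) (α : Type) : Type where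
  | ret (a : α) : Prog R n d α
  | tick (k : Prog R n d α) : Prog R n d α
  | const (c : ℕ) (k : R → Prog R n d α) : Prog R n d α
  | arith (o : ArithOp) (x y : R) (k : R → Prog R n d α) : Prog R n d α
  | sqrt (x : R) (k : R → Prog R n d α) : Prog R n d α
  | le (x y : R) (k : Bool → Prog R n d α) : Prog R n d α
  | agg (Y : Fin n → Fin d → R) (s : R) (k : (Fin d → R) → Prog R n d α) : Prog R n d α

namespace Prog

variable {R : Type} {n d : ℕ} {α β : Type}

/-- Sequential composition. -/
def bind : Prog R n d α → (α → Prog R n d β) → Prog R n d β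
  | .ret a, g => g a
  | .tick k, g => .tick (k.bind g)
  | .const c k, g => .const c (fun r => (k r).bind g)
  | .arith o x y k, g => .arith o x y (fun r => (k r).bind g)
  | .sqrt x k, g => .sqrt x (fun r => (k r).bind g)
  | .le x y k, g => .le x y (fun b => (k b).bind g)
  | .agg Y s k, g => .agg Y s (fun v => (k v).bind g)

instance : Monad (Prog R n d) where
  pure := Prog.ret
  bind := Prog.bind

def tickI : Prog R n d Unit := .tick (.ret ())
def constI (c : ℕ) : Prog R n d R := .const c .ret
def addI (x y : R) : Prog R n d R := .arith .add x y .ret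
def subI (x y : R) : Prog R n d R := .arith .sub x y .ret
def mulI (x y : R) : Prog R n d R := .arith .mul x y .ret
def divI (x y : R) : Prog R n d R := .arith .div x y .ret
def sqrtI (x : R) : Prog R n d R := .sqrt x .ret
def leI (x y : R) : Prog R n d Bool := .le x y .ret
def aggI (Y : Fin n → Fin d → R) (s : R) : Prog R n d (Fin d → R) := .agg Y s .ret

end Prog

/-- The value of an arithmetic instruction on real numbers. -/
noncomputable def ArithOp.eval : ArithOp → ℝ → ℝ → ℝ
  | .add, x, y => x + y
  | .sub, x, y => x - y
  | .mul, x, y => x * y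
  | .div, x, y => x / y

/-- Execution of a program on real numbers: the result and the running time. Every instruction
takes one unit of time, except that a call of the aggregator `F` on the input `(Y, s)` takes
time `T Y s`. -/
noncomputable def Prog.run {n d : ℕ} {α : Type}
    (F : (Fin n → Fin d → ℝ) → ℝ → Fin d → ℝ) (T : (Fin n → Fin d → ℝ) → ℝ → ℕ) :
    Prog ℝ n d α → α × ℕ
  | .ret a => (a, 0)
  | .tick k => ((k.run F T).1, (k.run F T).2 + 1)
  | .const c k => (((k (c : ℝ)).run F T).1, ((k (c : ℝ)).run F T).2 + 1)
  | .arith o x y k => (((k (o.eval x y)).run F T).1, ((k (o.eval x y)).run F T).2 + 1)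
  | .sqrt x k => (((k (Real.sqrt x)).run F T).1, ((k (Real.sqrt x)).run F T).2 + 1)
  | .le x y k => (((k (decide (x ≤ y))).run F T).1, ((k (decide (x ≤ y))).run F T).2 + 1)
  | .agg Y s k => (((k (F Y s)).run F T).1, ((k (F Y s)).run F T).2 + T Y s)

/-! ### The reduction algorithm -/

namespace Reduction

variable {R : Type} {n d : ℕ} {α : Type}

/-- Fill an array, one step per cell besides the computation of its entry. -/
def tabulate : {k : ℕ} → (Fin k → Prog R n d α) → Prog R n d (Fin k → α)
  | 0, _ => pure Fin.elim0
  | _ + 1, t => do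
      let a ← t 0
      Prog.tickI
      let v ← tabulate (fun i => t i.succ)
      pure (Fin.cons a v)

/-- Add up computed numbers. -/
def sum : {k : ℕ} → (Fin k → Prog R n d R) → Prog R n d R
  | 0, _ => Prog.constI 0
  | _ + 1, t => do
      let a ← t 0
      let s ← sum (fun i => t i.succ)
      Prog.addI a s

def dot (u v : Fin d → R) : Prog R n d R :=
  sum (fun k => Prog.mulI (u k) (v k))

/-- The arithmetic mean of the input vectors. -/
def mean (Y : Fin n → Fin d → R) : Prog R n d (Fin d → R) :=
  tabulate (fun k => do
    let s ← sum (fun i => pure (Y i k))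
    let c ← Prog.constI n
    Prog.divI s c)

def vsub (u v : Fin d → R) : Prog R n d (Fin d → R) :=
  tabulate (fun k => Prog.subI (u k) (v k))

/-- `u / ‖u‖`. -/
def normalize (u : Fin d → R) : Prog R n d (Fin d → R) := do
  let q ← dot u u
  let r ← Prog.sqrtI q
  tabulate (fun k => Prog.divI (u k) r)

/-- Merge two lists of scored indices, larger scores first. -/
def merge : List (R × Fin n) → List (R × Fin n) → Prog R n d (List (R × Fin n))
  | [], ys => do
      Prog.tickI
      pure ys
  | x :: xs, [] => do
      Prog.tickI
      pure (x :: xs)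
  | x :: xs, y :: ys => do
      let b ← Prog.leI y.1 x.1
      Prog.tickI
      if b then do
        let l ← merge xs (y :: ys)
        pure (x :: l)
      else do
        let l ← merge (x :: xs) ys
        pure (y :: l)
  termination_by xs ys => xs.length + ys.length

/-- Merge neighbouring lists. -/
def mergePairs : List (List (R × Fin n)) → Prog R n d (List (List (R × Fin n)))
  | [] => pure []
  | [l] => do
      Prog.tickI
      pure [l]
  | l₁ :: l₂ :: ls => do
      let l ← merge l₁ l₂
      Prog.tickI
      let r ← mergePairs ls
      pure (l :: r)

/-- Repeat `mergePairs`, for at most `k` rounds, until one list is left. -/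
def mergeAll : (k : ℕ) → List (List (R × Fin n)) → Prog R n d (List (R × Fin n))
  | _, [] => pure []
  | _, [l] => pure l
  | 0, _ :: _ :: _ => pure []
  | k + 1, l₁ :: l₂ :: ls => do
      let r ← mergePairs (l₁ :: l₂ :: ls)
      mergeAll k r

/-- One single-element list per index. -/
def singletons (score : Fin n → R) : List (Fin n) → Prog R n d (List (List (R × Fin n)))
  | [] => pure []
  | i :: is => do
      Prog.tickI
      let r ← singletons score is
      pure ([(score i, i)] :: r)

/-- All indices in the order of decreasing score, by merge sort. -/
def ranking (score : Fin n → R) : Prog R n d (List (R × Fin n)) := do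
  let ls ← singletons score (List.finRange n)
  mergeAll n ls

/-- The indices in the first `m` entries of a list. -/
def top : (m : ℕ) → List (R × Fin n) → Prog R n d (List (Fin n))
  | 0, _ => pure []
  | _ + 1, [] => pure []
  | m + 1, x :: xs => do
      Prog.tickI
      let r ← top m xs
      pure (x.2 :: r)

/-- The first listed `j` with `⟨Y i, Y j⟩ = 0`; the last entry of the list if there is none. -/
def search (Y : Fin n → Fin d → R) (i : Fin n) : Fin n → List (Fin n) → Prog R n d (Fin n)
  | last, [] => pure last
  | _, j :: js => do
      Prog.tickI
      let p ← dot (Y i) (Y j)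
      let z ← Prog.constI 0
      let a ← Prog.leI p z
      let b ← Prog.leI z p
      if a && b then pure j else search Y i j js

/-- The reduction: rank the vectors `y` of `Y` by `⟨mean Y - f (Y), y / ‖y‖⟩`, keep the `m` highest
ranked ones, look among them for a vector orthogonal to the first one, and return the difference
of these two vectors after normalization. -/
def algorithm (m : ℕ) (Y : Fin n → Fin d → R) (s : R) : Prog R n d (Fin d → R) := do
  let mu' ← mean Y
  let muf ← Prog.aggI Y s
  let w ← vsub mu' muf
  let score ← tabulate (fun i => do
    let u ← normalize (Y i)
    dot w u)
  let L ← ranking score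
  let C ← top m L
  match C with
  | [] => tabulate (fun _ => Prog.constI 0)
  | i :: is => do
      let j ← search Y i i is
      let u ← normalize (Y i)
      let v ← normalize (Y j)
      vsub u v

end Reduction

/-- Execution of the reduction on the `n` vectors `Y` in `ℝ^d`, with `m` vectors to select, an
aggregator `f` whose running time is `T`, and the auxiliary number `s` that is handed to `f`. -/
noncomputable def runReduction {n d : ℕ}
    (f : (Fin n → EuclideanSpace ℝ (Fin d)) → ℝ → EuclideanSpace ℝ (Fin d))
    (T : (Fin n → EuclideanSpace ℝ (Fin d)) → ℝ → ℕ)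
    (m : ℕ) (Y : Fin n → EuclideanSpace ℝ (Fin d)) (s : ℝ) : (Fin d → ℝ) × ℕ :=
  (Reduction.algorithm m (fun i k => Y i k) s).run
    (fun Z t k => f (fun i => WithLp.toLp 2 (Z i)) t k)
    (fun Z t => T (fun i => WithLp.toLp 2 (Z i)) t)

/-- The vector that the reduction returns. -/
noncomputable def reductionOutput {n d : ℕ}
    (f : (Fin n → EuclideanSpace ℝ (Fin d)) → ℝ → EuclideanSpace ℝ (Fin d))
    (T : (Fin n → EuclideanSpace ℝ (Fin d)) → ℝ → ℕ)
    (m : ℕ) (Y : Fin n → EuclideanSpace ℝ (Fin d)) (s : ℝ) : EuclideanSpace ℝ (Fin d) :=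
  WithLp.toLp 2 (runReduction f T m Y s).1

/-- The running time of the reduction, including the call of the aggregator. -/
noncomputable def reductionTime {n d : ℕ}
    (f : (Fin n → EuclideanSpace ℝ (Fin d)) → ℝ → EuclideanSpace ℝ (Fin d))
    (T : (Fin n → EuclideanSpace ℝ (Fin d)) → ℝ → ℕ)
    (m : ℕ) (Y : Fin n → EuclideanSpace ℝ (Fin d)) (s : ℝ) : ℕ :=
  (runReduction f T m Y s).2

/-! ### Sample mean, covariance and robust aggregation -/

/-- The mean of `n` vectors. -/
noncomputable def sampleMean {n d : ℕ} (Y : Fin n → EuclideanSpace ℝ (Fin d)) :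
    EuclideanSpace ℝ (Fin d) :=
  (n : ℝ)⁻¹ • ∑ i, Y i

/-- The covariance matrix of `n` vectors, as an operator on `ℝ^d`; its operator norm is the
spectral norm, that is, the largest eigenvalue and the maximum variance. -/
noncomputable def sampleCov {n d : ℕ} (Y : Fin n → EuclideanSpace ℝ (Fin d)) :
    EuclideanSpace ℝ (Fin d) →L[ℝ] EuclideanSpace ℝ (Fin d) :=
  (n : ℝ)⁻¹ • ∑ i, InnerProductSpace.rankOne ℝ (Y i - sampleMean Y) (Y i - sampleMean Y)

/-- `v` is a unit eigenvector of the covariance matrix for the largest eigenvalue. -/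
def IsMaxVarianceDirection {n d : ℕ} (Y : Fin n → EuclideanSpace ℝ (Fin d))
    (v : EuclideanSpace ℝ (Fin d)) : Prop :=
  ‖v‖ = 1 ∧ sampleCov Y v = ‖sampleCov Y‖ • v

open Classical in
/-- `Y` arises from `X` by replacing at most an `ε` fraction of the vectors. -/
def IsCorruption {n d : ℕ} (ε : ℝ) (X Y : Fin n → EuclideanSpace ℝ (Fin d)) : Prop :=
  ((Finset.univ.filter (fun i => Y i ≠ X i)).card : ℝ) ≤ ε * n

/-- A strong robust aggregator: from any `ε`-corruption `Y` of any `X`, and from the maximum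
variance of `X`, it computes the mean of `X` up to a bias of at most
`τ * √ε * (maximum variance of X) ^ (1/2)`. -/
def IsStrongRobustAggregator {n d : ℕ} (ε τ : ℝ)
    (f : (Fin n → EuclideanSpace ℝ (Fin d)) → ℝ → EuclideanSpace ℝ (Fin d)) : Prop :=
  ∀ X Y : Fin n → EuclideanSpace ℝ (Fin d), IsCorruption ε X Y →
    ‖f Y ‖sampleCov X‖ - sampleMean X‖ ≤ τ * √ε * √‖sampleCov X‖

/-! ### The corrupted samples -/

/-- The placement of the corrupted vectors: the index sets `S₁`, `S₂` of the vectors placed along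
the two directions, and the offsets `l` of their distances from the origin from `√d`. -/
structure IsPlacement {n : ℕ} (d : ℕ) (ε : ℝ) (S₁ S₂ : Finset (Fin n)) (l : Fin n → ℝ) :
    Prop where
  disjoint : Disjoint S₁ S₂
  card_fst : (S₁.card : ℝ) = ε * n / 2
  card_snd : (S₂.card : ℝ) = ε * n / 2
  abs_lt : ∀ i ∈ S₁ ∪ S₂, |l i| < √(d : ℝ)
  sum_fst : ∑ i ∈ S₁, l i = 0
  sum_snd : ∑ i ∈ S₂, l i = 0
  sum_sq : ∑ i ∈ S₁, l i ^ 2 = ∑ i ∈ S₂, l i ^ 2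

/-- The corrupted set: the vectors of `X` with index in `S₁` are replaced by `(√d + l i) • b₁`,
those with index in `S₂` by `(√d + l i) • b₂`. -/
noncomputable def corrupted {n d : ℕ} (S₁ S₂ : Finset (Fin n)) (l : Fin n → ℝ)
    (b₁ b₂ : EuclideanSpace ℝ (Fin d)) (X : Fin n → EuclideanSpace ℝ (Fin d)) :
    Fin n → EuclideanSpace ℝ (Fin d) :=
  fun i => if i ∈ S₁ then (√(d : ℝ) + l i) • b₁
    else if i ∈ S₂ then (√(d : ℝ) + l i) • b₂ else X i

/-! ### Execution of the reduction -/

namespace Prog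

variable {n d : ℕ} {α β : Type} (F : (Fin n → Fin d → ℝ) → ℝ → Fin d → ℝ)
  (T : (Fin n → Fin d → ℝ) → ℝ → ℕ)

/-! Running time: the mean alone already costs `n * d` additions. Apart from the aggregator call,
everything costs O(nd) except merge sort, which makes O(log n) rounds of O(n) steps each.

Correctness splits into a deterministic statement on typical samples (`IsTypical.reduction_correct`)
and a tail bound (`measure_not_isTypical_le`). In a typical sample the Gaussian vectors have squared
norm of order d and pairwise inner products at most ηd, with η a small multiple of ε²/(1+τ)².
Expanding Gram sums, ηn ≥ 2 then forces ‖Cov(X)‖ ≤ 2ηd, and partial sums divided by n have norm at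
most √(2ηd). The zero-sum offsets shift the mean by (ε√d/2)(b₁+b₂), so mean(Y') - f(Y') is this
vector up to an error ε√d/20. Corrupted vectors score at least 0.45ε√d and all others at most 0.3ε√d
(`IsTypical.score_lt`). The selected vectors are therefore the corrupted ones, and orthogonality
separates the two groups.

For the angle, put D = b₁ - b₂. The placement gives b₁ and b₂ the same second moment σ, but
centering subtracts variance along b₁+b₂ and almost none along D. This leaves a spectral gap of
order ε²d, while the entries of the covariance between D and its complement are O(d/√n). The
perturbation bound `one_sub_inner_sq_le_of_gap` gives a squared sine of at most 576/(ε⁴n) on the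
whole typical event, which δ > 2 turns into Kδ²/n.

Typicality follows from Chernoff bounds for Gaussian sums and sums of squares, for fixed directions;
independence and Fubini transfer it to random ones. The union bound costs n² exp(-2cd), which is at
most n exp(-cd) whenever the latter is below 1. -/

theorem run_bind' (p : Prog ℝ n d α) (g : α → Prog ℝ n d β) :
    (p.bind g).run F T =
      (((g (p.run F T).1).run F T).1, (p.run F T).2 + ((g (p.run F T).1).run F T).2) := by
  induction p with
  | ret a => simp [Prog.bind, Prog.run]
  | tick k ih => simp only [Prog.bind, Prog.run, ih]; ext <;> simp; ring
  | const c k ih => simp only [Prog.bind, Prog.run, ih]; ext <;> simp; ring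
  | arith o x y k ih => simp only [Prog.bind, Prog.run, ih]; ext <;> simp; ring
  | sqrt x k ih => simp only [Prog.bind, Prog.run, ih]; ext <;> simp; ring
  | le x y k ih => simp only [Prog.bind, Prog.run, ih]; ext <;> simp; ring
  | agg Y s k ih => simp only [Prog.bind, Prog.run, ih]; ext <;> simp; ring

@[simp] theorem run_bind_fst (p : Prog ℝ n d α) (g : α → Prog ℝ n d β) :
    ((p >>= g).run F T).1 = ((g (p.run F T).1).run F T).1 := by
  have h := congrArg Prod.fst (run_bind' F T p g)
  exact h

@[simp] theorem run_bind_snd (p : Prog ℝ n d α) (g : α → Prog ℝ n d β) :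
    ((p >>= g).run F T).2 = (p.run F T).2 + ((g (p.run F T).1).run F T).2 := by
  have h := congrArg Prod.snd (run_bind' F T p g)
  exact h

@[simp] theorem run_pure (a : α) : (pure a : Prog ℝ n d α).run F T = (a, 0) := rfl

@[simp] theorem run_tickI : (tickI : Prog ℝ n d Unit).run F T = ((), 1) := rfl

@[simp] theorem run_constI (c : ℕ) : (constI c : Prog ℝ n d ℝ).run F T = ((c : ℝ), 1) := rfl

@[simp] theorem run_addI (x y : ℝ) : (addI x y : Prog ℝ n d ℝ).run F T = (x + y, 1) := rfl

@[simp] theorem run_subI (x y : ℝ) : (subI x y : Prog ℝ n d ℝ).run F T = (x - y, 1) := rfl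

@[simp] theorem run_mulI (x y : ℝ) : (mulI x y : Prog ℝ n d ℝ).run F T = (x * y, 1) := rfl

@[simp] theorem run_divI (x y : ℝ) : (divI x y : Prog ℝ n d ℝ).run F T = (x / y, 1) := rfl

@[simp] theorem run_sqrtI (x : ℝ) : (sqrtI x : Prog ℝ n d ℝ).run F T = (√x, 1) := rfl

@[simp] theorem run_leI (x y : ℝ) :
    (leI x y : Prog ℝ n d Bool).run F T = (decide (x ≤ y), 1) := rfl

@[simp] theorem run_aggI (Y : Fin n → Fin d → ℝ) (s : ℝ) :
    (aggI Y s : Prog ℝ n d (Fin d → ℝ)).run F T = (F Y s, T Y s) := by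
  simp [aggI, Prog.run]

end Prog

/-! ### Values and step counts of the subroutines. -/

namespace Reduction

variable {n d : ℕ} {α : Type} (F : (Fin n → Fin d → ℝ) → ℝ → Fin d → ℝ)
  (T : (Fin n → Fin d → ℝ) → ℝ → ℕ)

@[simp] theorem run_tabulate {k : ℕ} (t : Fin k → Prog ℝ n d α) :
    (tabulate t).run F T =
      (fun i => ((t i).run F T).1, ∑ i, (((t i).run F T).2 + 1)) := by
  induction k with
  | zero => ext i; exact i.elim0; simp [tabulate]
  | succ k ih =>
    ext i
    · simp only [tabulate, Prog.run_bind_fst, Prog.run_pure, ih]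
      refine Fin.cases ?_ (fun j => ?_) i <;> simp
    · simp only [tabulate, Prog.run_bind_snd, Prog.run_pure, ih, Fin.sum_univ_succ, Prog.run_tickI]
      ring

@[simp] theorem run_sum {k : ℕ} (t : Fin k → Prog ℝ n d ℝ) :
    (sum t).run F T = (∑ i, ((t i).run F T).1, 1 + ∑ i, (((t i).run F T).2 + 1)) := by
  induction k with
  | zero => ext <;> simp [sum]
  | succ k ih =>
    ext
    · simp [sum, ih, Fin.sum_univ_succ]
    · simp only [sum, Prog.run_bind_snd, Prog.run_addI, ih, Fin.sum_univ_succ]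
      ring

@[simp] theorem run_dot (u v : Fin d → ℝ) :
    (dot u v : Prog ℝ n d ℝ).run F T = (∑ k, u k * v k, 1 + 2 * d) := by
  simp [dot, mul_comm]

@[simp] theorem run_mean (Y : Fin n → Fin d → ℝ) :
    (mean Y).run F T = (fun k => (∑ i, Y i k) / n, d * (n + 4)) := by
  simp [mean]
  left
  ring

@[simp] theorem run_vsub (u v : Fin d → ℝ) :
    (vsub u v : Prog ℝ n d (Fin d → ℝ)).run F T = (fun k => u k - v k, d * 2) := by
  simp [vsub]

@[simp] theorem run_normalize (u : Fin d → ℝ) :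
    (normalize u : Prog ℝ n d (Fin d → ℝ)).run F T =
      (fun k => u k / √(∑ k, u k * u k), 4 * d + 2) := by
  ext
  · simp [normalize]
  · simp [normalize]; ring

/-- Identification with `List.merge`, from which permutation and sortedness are inherited. -/
theorem run_merge_fst (xs ys : List (ℝ × Fin n)) :
    ((merge xs ys : Prog ℝ n d _).run F T).1 =
      List.merge xs ys (fun x y => decide (y.1 ≤ x.1)) := by
  fun_induction List.merge xs ys (fun x y => decide (y.1 ≤ x.1)) with
  | case1 ys => simp [merge]
  | case2 xs h =>
    cases xs with
    | nil => simp [merge]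
    | cons x xs => simp [merge]
  | case3 x xs y ys h ih => simp_all [merge]
  | case4 x xs y ys h ih =>
    rw [decide_eq_true_iff] at h
    simp [merge, h, ih]

/-- Each recursive call pays a comparison and a tick and disposes of one entry; the last 1 is the
base case. -/
theorem run_merge_snd_le (xs ys : List (ℝ × Fin n)) :
    ((merge xs ys : Prog ℝ n d _).run F T).2 ≤ 2 * (xs.length + ys.length) + 1 := by
  fun_induction List.merge xs ys (fun x y => decide (y.1 ≤ x.1)) with
  | case1 ys => simp [merge]
  | case2 xs h =>
    cases xs with
    | nil => simp [merge]
    | cons x xs => simp [merge]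
  | case3 x xs y ys h ih =>
    rw [decide_eq_true_iff] at h
    simp [merge, h] at ih ⊢
    omega
  | case4 x xs y ys h ih =>
    rw [decide_eq_true_iff] at h
    simp [merge, h] at ih ⊢
    omega

/-- Lists of scored indices with weakly decreasing scores. -/
def ScoreSorted (l : List (ℝ × Fin n)) : Prop := l.Pairwise (fun x y => y.1 ≤ x.1)

theorem run_merge_perm (xs ys : List (ℝ × Fin n)) :
    List.Perm ((merge xs ys : Prog ℝ n d _).run F T).1 (xs ++ ys) := by
  rw [run_merge_fst]
  exact List.merge_perm_append _

theorem run_merge_sorted {xs ys : List (ℝ × Fin n)} (hx : ScoreSorted xs) (hy : ScoreSorted ys) :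
    ScoreSorted ((merge xs ys : Prog ℝ n d _).run F T).1 := by
  rw [run_merge_fst]
  have := List.pairwise_merge (le := fun x y : ℝ × Fin n => decide (y.1 ≤ x.1))
    (fun a b c h1 h2 => by simp at *; linarith) (fun a b => by simp; exact le_total _ _) xs ys
    (by simpa [ScoreSorted] using hx) (by simpa [ScoreSorted] using hy)
  simpa [ScoreSorted] using this

theorem run_mergePairs_perm (ls : List (List (ℝ × Fin n))) :
    List.Perm ((mergePairs ls : Prog ℝ n d _).run F T).1.flatten ls.flatten := by
  fun_induction mergePairs ls (R := ℝ) (d := d) with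
  | case1 => simp
  | case2 l => simp
  | case3 l₁ l₂ ls ih =>
    simp only [Prog.run_bind_fst, Prog.run_pure, List.flatten_cons]
    rw [← List.append_assoc]
    exact (run_merge_perm F T l₁ l₂).append ih

theorem run_mergePairs_sorted {ls : List (List (ℝ × Fin n))} (h : ∀ l ∈ ls, ScoreSorted l) :
    ∀ l ∈ ((mergePairs ls : Prog ℝ n d _).run F T).1, ScoreSorted l := by
  fun_induction mergePairs ls (R := ℝ) (d := d) with
  | case1 => simp
  | case2 l => simpa using h
  | case3 l₁ l₂ ls ih =>
    simp only [Prog.run_bind_fst, Prog.run_pure, List.mem_cons, forall_eq_or_imp] at h ⊢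
    exact ⟨run_merge_sorted F T h.1 h.2.1, ih h.2.2⟩

theorem run_mergePairs_length (ls : List (List (ℝ × Fin n))) :
    ((mergePairs ls : Prog ℝ n d _).run F T).1.length = (ls.length + 1) / 2 := by
  fun_induction mergePairs ls (R := ℝ) (d := d) with
  | case1 => simp
  | case2 l => simp
  | case3 l₁ l₂ ls ih =>
    simp only [Prog.run_bind_fst, Prog.run_pure, List.length_cons, ih]
    omega

/-- The additive 1 of a merge and the tick of its pair are charged to the two lists of the pair. -/
theorem run_mergePairs_snd_le (ls : List (List (ℝ × Fin n))) :
    ((mergePairs ls : Prog ℝ n d _).run F T).2 ≤ 2 * ls.flatten.length + ls.length := by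
  fun_induction mergePairs ls (R := ℝ) (d := d) with
  | case1 => simp
  | case2 l => simp
  | case3 l₁ l₂ ls ih =>
    have := run_merge_snd_le (d := d) F T l₁ l₂
    simp only [Prog.run_bind_snd, Prog.run_pure, List.length_cons,
      List.flatten_cons, List.length_append, Prog.run_tickI] at ih ⊢
    omega

/-- A round takes k + 2 lists to at most (k + 3) / 2 ≤ k + 1, so the round limit never cuts the sort
short and the default `[]` for two or more remaining lists is not reached. -/
theorem run_mergeAll_spec (k : ℕ) (ls : List (List (ℝ × Fin n))) (hk : ls.length ≤ k + 1)
    (h : ∀ l ∈ ls, ScoreSorted l) :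
    List.Perm ((mergeAll k ls : Prog ℝ n d _).run F T).1 ls.flatten ∧
      ScoreSorted ((mergeAll k ls : Prog ℝ n d _).run F T).1 := by
  induction k generalizing ls with
  | zero =>
    match ls, hk with
    | [], _ => simp [mergeAll, ScoreSorted]
    | [l], _ => simpa [mergeAll] using h
  | succ k ih =>
    match ls with
    | [] => simp [mergeAll, ScoreSorted]
    | [l] => simpa [mergeAll] using h
    | l₁ :: l₂ :: ls =>
      have hl := run_mergePairs_length (d := d) F T (l₁ :: l₂ :: ls)
      have := ih ((mergePairs (l₁ :: l₂ :: ls) : Prog ℝ n d _).run F T).1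
        (by rw [hl]; simp only [List.length_cons] at hk ⊢; omega)
        (run_mergePairs_sorted F T h)
      simp only [mergeAll, Prog.run_bind_fst]
      exact ⟨this.1.trans (run_mergePairs_perm F T _), this.2⟩

/-- The number of lists halves in each round, so `j` rounds suffice. Each costs at most 2N + c,
because the total number of entries is preserved and the number of lists does not grow. -/
theorem run_mergeAll_snd_le (k j N c : ℕ) (ls : List (List (ℝ × Fin n)))
    (hj : ls.length ≤ 2 ^ j) (hN : ls.flatten.length = N) (hc : ls.length ≤ c) :
    ((mergeAll k ls : Prog ℝ n d _).run F T).2 ≤ j * (2 * N + c) := by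
  induction k generalizing ls j with
  | zero =>
    match ls with
    | [] => simp [mergeAll]
    | [l] => simp [mergeAll]
    | l₁ :: l₂ :: ls => simp [mergeAll]
  | succ k ih =>
    match ls with
    | [] => simp [mergeAll]
    | [l] => simp [mergeAll]
    | l₁ :: l₂ :: ls =>
      have hl := run_mergePairs_length (d := d) F T (l₁ :: l₂ :: ls)
      have ht := run_mergePairs_snd_le (d := d) F T (l₁ :: l₂ :: ls)
      have hp := (run_mergePairs_perm (d := d) F T (l₁ :: l₂ :: ls)).length_eq
      cases j with
      | zero => simp at hj
      | succ j =>
        have := ih j ((mergePairs (l₁ :: l₂ :: ls) : Prog ℝ n d _).run F T).1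
          (by rw [hl]; rw [pow_succ] at hj; omega) (by rw [hp, hN])
          (by rw [hl]; simp only [List.length_cons] at hc ⊢; omega)
        simp only [mergeAll, Prog.run_bind_snd]
        rw [hN] at ht
        rw [Nat.add_mul]
        omega

theorem run_singletons (score : Fin n → ℝ) (is : List (Fin n)) :
    (singletons score is : Prog ℝ n d _).run F T =
      (is.map (fun i => [(score i, i)]), is.length) := by
  induction is with
  | nil => simp [singletons]
  | cons i is ih =>
    ext : 1
    · simp [singletons, ih]
    · simp [singletons, ih]; ring

theorem flatten_map_singleton {β γ : Type} (g : β → γ) (l : List β) :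
    (l.map (fun i => [g i])).flatten = l.map g := by
  induction l with
  | nil => rfl
  | cons a l ih => simp [ih]

theorem run_ranking_spec (score : Fin n → ℝ) :
    List.Perm ((ranking score : Prog ℝ n d _).run F T).1
        ((List.finRange n).map (fun i => (score i, i))) ∧
      ScoreSorted ((ranking score : Prog ℝ n d _).run F T).1 := by
  have := run_mergeAll_spec (d := d) F T n ((List.finRange n).map (fun i => [(score i, i)]))
    (by simp) (by
      simp only [List.mem_map, forall_exists_index, and_imp]
      rintro l i - rfl
      simp [ScoreSorted])
  rw [flatten_map_singleton] at this
  simpa [ranking, run_singletons] using this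

theorem run_ranking_snd_le (score : Fin n → ℝ) :
    ((ranking score : Prog ℝ n d _).run F T).2 ≤ n + (Nat.log 2 n + 1) * (3 * n) := by
  have := run_mergeAll_snd_le (d := d) F T n (Nat.log 2 n + 1) n n
    ((List.finRange n).map (fun i => [(score i, i)]))
    (by simpa using (Nat.lt_pow_succ_log_self (by norm_num : 1 < 2) n).le)
    (by rw [flatten_map_singleton]; simp) (by simp)
  simp only [ranking, run_singletons, Prog.run_bind_snd, List.length_finRange]
  have h3 : 2 * n + n = 3 * n := by ring
  rw [h3] at this
  omega

theorem run_top_fst (m : ℕ) (L : List (ℝ × Fin n)) :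
    ((top m L : Prog ℝ n d _).run F T).1 = (L.map Prod.snd).take m := by
  induction m generalizing L with
  | zero => simp [top]
  | succ m ih => cases L <;> simp [top, ih]

theorem run_top_snd_le (m : ℕ) (L : List (ℝ × Fin n)) :
    ((top m L : Prog ℝ n d _).run F T).2 ≤ L.length := by
  induction m generalizing L with
  | zero => simp [top]
  | succ m ih =>
    cases L with
    | nil => simp [top]
    | cons x xs =>
      have := ih xs
      simp [top]
      omega

theorem run_search_fst (Y : Fin n → Fin d → ℝ) (i last : Fin n) (js : List (Fin n)) :
    ((search Y i last js).run F T).1 =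
      (js.find? (fun j => decide (∑ k, Y i k * Y j k = 0))).getD (js.getLastD last) := by
  induction js generalizing last with
  | nil => simp [search]
  | cons j js ih =>
    by_cases h : ∑ k, Y i k * Y j k = 0
    · simp [search, h]
    -- The machine tests equality with zero by two comparisons.
    · have h2 : ¬ ((decide (∑ k, Y i k * Y j k ≤ ((0 : ℕ) : ℝ)) &&
          decide (((0 : ℕ) : ℝ) ≤ ∑ k, Y i k * Y j k)) = true) := by
        simpa using fun h' h'' => h (le_antisymm h' h'')
      simp only [search, Prog.run_bind_fst, run_dot, Prog.run_constI, Prog.run_leI]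
      refine (congrArg (fun q => (Prog.run F T q).1) (if_neg h2)).trans ?_
      rw [ih, List.find?_cons_of_neg (by simpa using h)]
      simp [List.getLast?_cons]

theorem run_search_snd_le (Y : Fin n → Fin d → ℝ) (i last : Fin n) (js : List (Fin n)) :
    ((search Y i last js).run F T).2 ≤ js.length * (2 * d + 5) := by
  induction js generalizing last with
  | nil => simp [search]
  | cons j js ih =>
    simp only [search, Prog.run_bind_snd, run_dot, Prog.run_constI,
      Prog.run_leI, Prog.run_tickI]
    rw [List.length_cons, Nat.add_mul]
    -- The bound holds for either branch, so the test need not be evaluated.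
    have key : ∀ q : Prog ℝ n d (Fin n), (q = pure j ∨ q = search Y i j js) →
        1 + (1 + 2 * d + (1 + (1 + (1 + (q.run F T).2)))) ≤
          js.length * (2 * d + 5) + 1 * (2 * d + 5) := by
      rintro q (rfl | rfl)
      · simp only [Prog.run_pure]
        omega
      · have := ih j
        omega
    exact key _ (ite_eq_or_eq _ _ _)

/-- The direction of a vector, given by its coordinates. -/
noncomputable def unitVec (u : Fin d → ℝ) : Fin d → ℝ := fun k => u k / √(∑ k, u k * u k)

/-- The score of the `i`-th vector: the inner product of its direction with `mean Y - f Y`. -/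
noncomputable def scoreOf (Y : Fin n → Fin d → ℝ) (s : ℝ) (i : Fin n) : ℝ :=
  ∑ k, ((∑ i, Y i k) / n - F Y s k) * unitVec (Y i) k

/-- The order `J` is only asserted to exist: how ties are broken is irrelevant later. -/
theorem run_algorithm_fst (m : ℕ) (Y : Fin n → Fin d → ℝ) (s : ℝ) :
    ∃ J : List (Fin n), J.Perm (List.finRange n) ∧
      J.Pairwise (fun i j => scoreOf F Y s j ≤ scoreOf F Y s i) ∧
      ∀ i is, J.take m = i :: is → ((algorithm m Y s).run F T).1 = fun k =>
        unitVec (Y i) k - unitVec (Y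
          ((is.find? (fun j => decide (∑ k, Y i k * Y j k = 0))).getD (is.getLastD i))) k := by
  have hs := run_ranking_spec (d := d) F T (scoreOf F Y s)
  set L := ((ranking (scoreOf F Y s) : Prog ℝ n d _).run F T).1 with hL
  -- Every entry carries the score of its own index, so order by first components is order by
  -- `scoreOf`.
  have hmem : ∀ x ∈ L, x.1 = scoreOf F Y s x.2 := by
    intro x hx
    have := hs.1.subset hx
    simp only [List.mem_map] at this
    obtain ⟨i, -, rfl⟩ := this
    rfl
  refine ⟨L.map Prod.snd, ?_, ?_, ?_⟩
  · simpa [Function.comp_def] using hs.1.map Prod.snd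
  · rw [List.pairwise_map]
    refine hs.2.imp_of_mem fun {a b} ha hb h => ?_
    rw [← hmem a ha, ← hmem b hb]
    exact h
  · intro i is h
    have hsc : (fun i => ∑ k, ((∑ i, Y i k) / n - F Y s k) * (Y i k / √(∑ k, Y i k * Y i k))) =
      scoreOf F Y s := rfl
    simp only [algorithm, Prog.run_bind_fst, run_mean, Prog.run_aggI, run_vsub, run_tabulate,
      run_normalize, run_dot, run_top_fst, hsc, ← hL, h, run_search_fst]
    rfl

/-- The lower bound comes from the mean alone. The upper summands are the costs of the mean, `w`,
scores, ranking, selection and search; 10d + 4 pays for two normalizations and the final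
subtraction. -/
theorem run_algorithm_snd (m : ℕ) (Y : Fin n → Fin d → ℝ) (s : ℝ) :
    T Y s + n * d ≤ ((algorithm m Y s).run F T).2 ∧
    ((algorithm m Y s).run F T).2 ≤
      T Y s + (d * (n + 4) + d * 2 + n * (6 * d + 4) + (n + (Nat.log 2 n + 1) * (3 * n)) + n +
        n * (2 * d + 5) + 10 * d + 4) := by
  set sc := fun i => ∑ k, ((∑ i, Y i k) / n - F Y s k) * (Y i k / √(∑ k, Y i k * Y i k))
    with hsc
  set L := ((ranking sc : Prog ℝ n d _).run F T).1 with hL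
  have hlen : L.length = n := by
    simpa using (run_ranking_spec (d := d) F T sc).1.length_eq
  have h1 := run_ranking_snd_le (d := d) F T sc
  have h2 := run_top_snd_le (d := d) F T m L
  have h3 := run_top_fst (d := d) F T m L
  set C := ((top m L : Prog ℝ n d _).run F T).1 with hC
  have hClen : C.length ≤ n := by rw [h3, List.length_take, List.length_map, hlen]; omega
  simp only [algorithm, Prog.run_bind_snd, run_mean, Prog.run_aggI, run_vsub, run_tabulate,
    run_normalize, run_dot, Prog.run_bind_fst, ← hsc, ← hL, ← hC]
  have h4 : ∑ _i : Fin n, (4 * d + 2 + (1 + 2 * d) + 1) = n * (6 * d + 4) := by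
    simp; left; ring
  have h0 : d * (n + 4) = n * d + 4 * d := by ring
  rw [h4, h0]
  rw [hlen] at h2
  match C, hClen with
  | [], _ =>
    simp only [run_tabulate, Prog.run_constI, Finset.sum_const, Finset.card_univ,
      Fintype.card_fin, smul_eq_mul]
    constructor <;> omega
  | i :: is, hC' =>
    have h5 := run_search_snd_le F T Y i i is
    have h6 : is.length * (2 * d + 5) ≤ n * (2 * d + 5) :=
      Nat.mul_le_mul_right _ (by simp at hC'; omega)
    simp only [Prog.run_bind_snd, run_normalize, run_vsub]
    constructor <;> omega

end Reduction

/-! ### Quasilinear time bound, and selection by score. -/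

theorem natLog_two_le_two_mul_log (n : ℕ) (hn : 0 < n) : (Nat.log 2 n : ℝ) ≤ 2 * Real.log n := by
  have h : ((2 : ℝ) ^ Nat.log 2 n) ≤ n := by exact_mod_cast Nat.pow_log_le_self 2 hn.ne'
  have h2 := Real.log_le_log (by positivity) h
  rw [Real.log_pow] at h2
  have h3 := Real.log_two_gt_d9
  have h4 : (0 : ℝ) ≤ Nat.log 2 n := by positivity
  nlinarith

theorem reductionTime_bounds {n d : ℕ} (m : ℕ) (hn : 0 < n) (hd : 0 < d)
    (f : (Fin n → EuclideanSpace ℝ (Fin d)) → ℝ → EuclideanSpace ℝ (Fin d))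
    (T : (Fin n → EuclideanSpace ℝ (Fin d)) → ℝ → ℕ)
    (Y : Fin n → EuclideanSpace ℝ (Fin d)) (s : ℝ) :
    (T Y s : ℝ) + (n : ℝ) * d ≤ reductionTime f T m Y s ∧
      (reductionTime f T m Y s : ℝ) ≤
        T Y s + 60 * ((n : ℝ) * d) * (1 + Real.log ((n : ℝ) * d)) := by
  obtain ⟨h1, h2⟩ := Reduction.run_algorithm_snd (fun Z t k => f (fun i => WithLp.toLp 2 (Z i)) t k)
    (fun Z t => T (fun i => WithLp.toLp 2 (Z i)) t) m (fun i k => Y i k) s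
  have hT : T (fun i => WithLp.toLp 2 (fun k => Y i k)) s = T Y s := rfl
  simp only [hT] at h1 h2
  change _ ≤ reductionTime f T m Y s at h1
  change reductionTime f T m Y s ≤ _ at h2
  have h1' : ((T Y s + n * d : ℕ) : ℝ) ≤ reductionTime f T m Y s := by exact_mod_cast h1
  have h2' := (Nat.cast_le (α := ℝ)).2 h2
  push_cast at h1' h2'
  refine ⟨h1', h2'.trans ?_⟩
  have hn' : (1 : ℝ) ≤ n := by exact_mod_cast hn
  have hd' : (1 : ℝ) ≤ d := by exact_mod_cast hd
  have hlog := natLog_two_le_two_mul_log n hn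
  have hlog2 : Real.log n ≤ Real.log (n * d) := Real.log_le_log (by linarith) (by nlinarith)
  have hlog0 : 0 ≤ Real.log n := Real.log_nonneg hn'
  set ℓ := Real.log (n * d)
  have e1 : (n : ℝ) ≤ n * d := by nlinarith
  have e2 : (d : ℝ) ≤ n * d := by nlinarith
  have e3 : (n : ℝ) * Nat.log 2 n ≤ n * d * (2 * ℓ) :=
    mul_le_mul e1 (by linarith) (by positivity) (by positivity)
  have e4 : (1 : ℝ) ≤ n * d := by linarith
  have e5 : 0 ≤ n * d * ℓ := by
    have : 0 ≤ ℓ := by linarith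
    positivity
  -- Here 9nd + 16d + 14n + 4 ≤ 43nd, and the sorting term 3n log₂ n is at most 6ndℓ; 60 covers
  -- both.
  nlinarith

/-- A list sorted by decreasing score starts with the elements of `S`, in some order, if they
have the highest scores. -/
theorem mem_take_iff_of_score_lt {n : ℕ} {J : List (Fin n)} (hJ : J.Perm (List.finRange n))
    {g : Fin n → ℝ} (hs : J.Pairwise (fun i j => g j ≤ g i)) {S : Finset (Fin n)}
    (hS : ∀ i ∈ S, ∀ j ∉ S, g j < g i) (i : Fin n) : i ∈ J.take S.card ↔ i ∈ S := by
  have hnd : J.Nodup := hJ.nodup_iff.2 (List.nodup_finRange n)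
  have hlen : J.length = n := by simpa using hJ.length_eq
  have hcard : (J.take S.card).toFinset.card = S.card := by
    rw [List.toFinset_card_of_nodup (hnd.sublist (List.take_sublist _ _)), List.length_take, hlen]
    have := S.card_le_univ
    simp at this
    omega
  -- As the cardinalities agree, an intruder in the prefix would push some element of `S` into the
  -- tail, against the sorting.
  have hsub : (J.take S.card).toFinset ⊆ S := by
    intro i hi
    by_contra hiS
    obtain ⟨s, hsS, hs'⟩ : ∃ s ∈ S, s ∉ (J.take S.card).toFinset := by
      by_contra! h
      have : S = (J.take S.card).toFinset := Finset.eq_of_subset_of_card_le h hcard.le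
      exact hiS (this ▸ hi)
    have hsJ : s ∈ J.take S.card ++ J.drop S.card := by
      rw [List.take_append_drop]; exact hJ.mem_iff.2 (List.mem_finRange s)
    rw [List.mem_toFinset] at hi hs'
    have hsd : s ∈ J.drop S.card := (List.mem_append.1 hsJ).resolve_left hs'
    rw [← List.take_append_drop S.card J, List.pairwise_append] at hs
    exact absurd (hs.2.2 i hi s hsd) (not_le.2 (hS s hsS i hiS))
  rw [← List.mem_toFinset, Finset.eq_of_subset_of_card_le hsub hcard.ge]

/-! ### Sums of nearly orthogonal vectors, and covariance -/

section NearlyOrthogonal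

variable {ι E : Type*} [NormedAddCommGroup E] [InnerProductSpace ℝ E]

/-- In the Gram expansion the diagonal gives a ∑ q², and the rest at most b (∑ |q|)² ≤ b |S| ∑ q².
-/
theorem norm_sum_smul_sq_le {S : Finset ι} {x : ι → E} {a b : ℝ} (hb : 0 ≤ b)
    (ha : ∀ i, ‖x i‖ ^ 2 ≤ a) (hx : ∀ i j, i ≠ j → |inner ℝ (x i) (x j)| ≤ b) (q : ι → ℝ) :
    ‖∑ i ∈ S, q i • x i‖ ^ 2 ≤ (a + b * S.card) * ∑ i ∈ S, q i ^ 2 := by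
  classical
  have h1 : ‖∑ i ∈ S, q i • x i‖ ^ 2 =
      ∑ i ∈ S, ∑ j ∈ S, q i * q j * inner ℝ (x i) (x j) := by
    rw [← real_inner_self_eq_norm_sq, sum_inner]
    refine Finset.sum_congr rfl fun i _ => ?_
    rw [inner_sum]
    refine Finset.sum_congr rfl fun j _ => ?_
    rw [real_inner_smul_left, real_inner_smul_right]
    ring
  have h2 : ∀ i ∈ S, ∀ j ∈ S, q i * q j * inner ℝ (x i) (x j) ≤
      (if i = j then a * q i ^ 2 else 0) + b * (|q i| * |q j|) := by
    intro i _ j _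
    split_ifs with h
    · subst h
      rw [real_inner_self_eq_norm_sq]
      have := mul_le_mul_of_nonneg_left (ha i) (sq_nonneg (q i))
      have : 0 ≤ b * (|q i| * |q i|) := by positivity
      nlinarith
    · calc q i * q j * inner ℝ (x i) (x j) ≤ |q i * q j * inner ℝ (x i) (x j)| := le_abs_self _
        _ = |q i| * |q j| * |inner ℝ (x i) (x j)| := by rw [abs_mul, abs_mul]
        _ ≤ |q i| * |q j| * b := mul_le_mul_of_nonneg_left (hx i j h) (by positivity)
        _ = _ := by ring
  have h3 : ∑ i ∈ S, ∑ j ∈ S, ((if i = j then a * q i ^ 2 else 0) + b * (|q i| * |q j|)) =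
      a * ∑ i ∈ S, q i ^ 2 + b * (∑ i ∈ S, |q i|) ^ 2 := by
    simp_rw [Finset.sum_add_distrib]
    congr 1
    · rw [Finset.mul_sum]
      refine Finset.sum_congr rfl fun i hi => ?_
      simp [hi]
    · rw [sq, Finset.sum_mul_sum, Finset.mul_sum]
      exact Finset.sum_congr rfl fun i _ => (Finset.mul_sum _ _ _).symm
  have h4 : (∑ i ∈ S, |q i|) ^ 2 ≤ S.card * ∑ i ∈ S, q i ^ 2 := by
    simpa using sq_sum_le_card_mul_sum_sq (s := S) (f := fun i => |q i|)
  rw [h1]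
  calc _ ≤ _ := Finset.sum_le_sum fun i hi => Finset.sum_le_sum fun j hj => h2 i hi j hj
    _ = _ := h3
    _ ≤ a * ∑ i ∈ S, q i ^ 2 + b * (S.card * ∑ i ∈ S, q i ^ 2) := by gcongr
    _ = _ := by ring

/-- Dual form: the sum Q equals ⟨∑ ⟨xᵢ, v⟩ xᵢ, v⟩, so Cauchy–Schwarz bounds Q² by (a + b|S|) ‖v‖² Q,
and one Q cancels. -/
theorem sum_inner_sq_le {S : Finset ι} {x : ι → E} {a b : ℝ} (hb : 0 ≤ b) (ha0 : 0 ≤ a)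
    (ha : ∀ i, ‖x i‖ ^ 2 ≤ a) (hx : ∀ i j, i ≠ j → |inner ℝ (x i) (x j)| ≤ b) (v : E) :
    ∑ i ∈ S, inner ℝ (x i) v ^ 2 ≤ (a + b * S.card) * ‖v‖ ^ 2 := by
  set Q := ∑ i ∈ S, inner ℝ (x i) v ^ 2 with hQ
  have hQ0 : 0 ≤ Q := Finset.sum_nonneg fun i _ => sq_nonneg _
  have h1 : Q = inner ℝ (∑ i ∈ S, inner ℝ (x i) v • x i) v := by
    rw [sum_inner]
    refine Finset.sum_congr rfl fun i _ => ?_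
    rw [real_inner_smul_left, sq]
  have h2 := norm_sum_smul_sq_le (S := S) hb ha hx (fun i => inner ℝ (x i) v)
  have h3 := real_inner_mul_inner_self_le (∑ i ∈ S, inner ℝ (x i) v • x i) v
  rw [← h1, real_inner_self_eq_norm_sq, real_inner_self_eq_norm_sq] at h3
  have h4 : Q * Q ≤ ((a + b * S.card) * ‖v‖ ^ 2) * Q :=
    h3.trans ((mul_le_mul_of_nonneg_right h2 (sq_nonneg _)).trans (le_of_eq (by ring)))
  rcases hQ0.eq_or_lt with h | h
  · rw [← h]; positivity
  · exact le_of_mul_le_mul_right h4 h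

/-- A maximizing eigenvector of an operator that nearly has the eigenvector `D` with a spectral
gap is close to the line of `D`. -/
theorem one_sub_inner_sq_le_of_gap {M : E →L[ℝ] E} {v D : E} {s α γ β : ℝ}
    (hv : ‖v‖ = 1) (hMv : M v = ‖M‖ • v) (hD : ‖D‖ ^ 2 = 2) (hαγ : α < γ)
    (hDD : 2 * (s - α) ≤ inner ℝ D (M D))
    (huu : ∀ u, inner ℝ D u = 0 → inner ℝ u (M u) ≤ (s - γ) * ‖u‖ ^ 2)
    (hDu : ∀ u, inner ℝ D u = 0 → |inner ℝ u (M D)| ≤ β * ‖u‖) :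
    1 - inner ℝ D v ^ 2 / 2 ≤ (β / (γ - α)) ^ 2 := by
  -- Split v = cD + u with u ⟂ D, so that ‖u‖² is the left side of the goal. Pairing the eigenvalue
  -- equation with u gives ‖M‖‖u‖² ≤ β‖u‖ + (s - γ)‖u‖², while testing M on D gives ‖M‖ ≥ s - α.
  set c := inner ℝ D v / 2 with hc
  set u := v - c • D with hu
  have hDu0 : inner ℝ D u = 0 := by
    rw [hu, inner_sub_right, real_inner_smul_right, real_inner_self_eq_norm_sq, hD, hc]; ring
  have huD0 : inner ℝ u D = 0 := by rw [real_inner_comm]; exact hDu0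
  have hvu : v = c • D + u := by rw [hu]; abel
  have hun : ‖u‖ ^ 2 = 1 - inner ℝ D v ^ 2 / 2 := by
    rw [hu, norm_sub_sq_real, hv, norm_smul, mul_pow, hD, real_inner_smul_right,
      real_inner_comm D v, hc, Real.norm_eq_abs, sq_abs]
    ring
  have hlam : s - α ≤ ‖M‖ := by
    have h1 : inner ℝ D (M D) ≤ ‖M‖ * 2 := by
      calc inner ℝ D (M D) ≤ ‖D‖ * ‖M D‖ := real_inner_le_norm _ _
        _ ≤ ‖D‖ * (‖M‖ * ‖D‖) := by gcongr; exact M.le_opNorm D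
        _ = ‖M‖ * ‖D‖ ^ 2 := by ring
        _ = _ := by rw [hD]
    linarith
  have hcabs : |c| ≤ 1 := by
    have : c ^ 2 ≤ 1 := by
      have h0 : (0 : ℝ) ≤ ‖u‖ ^ 2 := sq_nonneg _
      rw [hun] at h0
      rw [hc]
      nlinarith
    exact (sq_le_one_iff_abs_le_one c).1 this
  have h1 : inner ℝ u (M v) = ‖M‖ * ‖u‖ ^ 2 := by
    rw [hMv, real_inner_smul_right]
    congr 1
    conv_lhs => rw [hvu]
    rw [inner_add_right, real_inner_smul_right, huD0, real_inner_self_eq_norm_sq]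
    ring
  have h2 : inner ℝ u (M v) = c * inner ℝ u (M D) + inner ℝ u (M u) := by
    conv_lhs => rw [hvu]
    rw [map_add, map_smul, inner_add_right, real_inner_smul_right]
  have h3 : c * inner ℝ u (M D) ≤ β * ‖u‖ := by
    calc c * inner ℝ u (M D) ≤ |c * inner ℝ u (M D)| := le_abs_self _
      _ = |c| * |inner ℝ u (M D)| := abs_mul _ _
      _ ≤ 1 * (β * ‖u‖) := mul_le_mul hcabs (hDu u hDu0) (abs_nonneg _) zero_le_one
      _ = _ := one_mul _
  have h4 := huu u hDu0
  have h5 : (γ - α) * ‖u‖ ^ 2 ≤ β * ‖u‖ := by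
    have := mul_le_mul_of_nonneg_right hlam (sq_nonneg ‖u‖)
    nlinarith
  have hg : 0 < γ - α := by linarith
  rw [← hun]
  rcases (norm_nonneg u).eq_or_lt with h | h
  · rw [← h, zero_pow two_ne_zero]; positivity
  · have h6 : (γ - α) * ‖u‖ ≤ β := by
      have : ((γ - α) * ‖u‖) * ‖u‖ ≤ β * ‖u‖ := by nlinarith
      exact le_of_mul_le_mul_right this h
    have : ‖u‖ ≤ β / (γ - α) := by rw [le_div_iff₀ hg]; linarith
    gcongr

end NearlyOrthogonal

/-! ### The sample covariance as a bilinear form. -/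

section Covariance

variable {n d : ℕ}

theorem inner_sampleMean (Y : Fin n → EuclideanSpace ℝ (Fin d)) (v : EuclideanSpace ℝ (Fin d)) :
    inner ℝ (sampleMean Y) v = (n : ℝ)⁻¹ * ∑ i, inner ℝ (Y i) v := by
  rw [sampleMean, real_inner_smul_left, sum_inner]

theorem inner_sampleCov (Y : Fin n → EuclideanSpace ℝ (Fin d)) (u v : EuclideanSpace ℝ (Fin d)) :
    inner ℝ u (sampleCov Y v) =
      (n : ℝ)⁻¹ * ∑ i, inner ℝ (Y i - sampleMean Y) u * inner ℝ (Y i - sampleMean Y) v := by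
  simp only [sampleCov, smul_apply, sum_apply,
    InnerProductSpace.rankOne_apply, real_inner_smul_right, inner_sum]
  congr 1
  refine Finset.sum_congr rfl fun i _ => ?_
  rw [real_inner_comm u, mul_comm]

theorem inner_sampleCov_eq (hn : 0 < n) (Y : Fin n → EuclideanSpace ℝ (Fin d))
    (u v : EuclideanSpace ℝ (Fin d)) :
    inner ℝ u (sampleCov Y v) = (n : ℝ)⁻¹ * ∑ i, inner ℝ (Y i) u * inner ℝ (Y i) v -
      inner ℝ (sampleMean Y) u * inner ℝ (sampleMean Y) v := by
  have hn' : (n : ℝ) ≠ 0 := by positivity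
  rw [inner_sampleCov]
  simp_rw [inner_sub_left, sub_mul, mul_sub, Finset.sum_sub_distrib, ← Finset.mul_sum,
    ← Finset.sum_mul]
  simp only [Finset.sum_const, Finset.card_univ, Fintype.card_fin, nsmul_eq_mul]
  rw [inner_sampleMean, inner_sampleMean]
  field_simp
  ring

/-- Centering only lowers second moments. For u = Cov v, Cauchy–Schwarz over the sample gives ‖u‖⁴ ≤
h‖u‖² · h‖v‖². -/
theorem norm_sampleCov_le (hn : 0 < n) (Y : Fin n → EuclideanSpace ℝ (Fin d)) {h : ℝ} (h0 : 0 ≤ h)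
    (hY : ∀ v, (n : ℝ)⁻¹ * ∑ i, inner ℝ (Y i) v ^ 2 ≤ h * ‖v‖ ^ 2) : ‖sampleCov Y‖ ≤ h := by
  have hc : ∀ v, (n : ℝ)⁻¹ * ∑ i, inner ℝ (Y i - sampleMean Y) v ^ 2 ≤ h * ‖v‖ ^ 2 := by
    intro v
    have h1 := inner_sampleCov Y v v
    have h2 := inner_sampleCov_eq hn Y v v
    have h3 := hY v
    simp_rw [← sq] at h1 h2
    nlinarith [sq_nonneg (inner ℝ (sampleMean Y) v)]
  have hn' : (0 : ℝ) < n := by positivity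
  refine ContinuousLinearMap.opNorm_le_bound _ h0 fun v => ?_
  set u := sampleCov Y v with hu
  have h1 : ‖u‖ ^ 2 = (n : ℝ)⁻¹ *
      ∑ i, inner ℝ (Y i - sampleMean Y) u * inner ℝ (Y i - sampleMean Y) v := by
    rw [← real_inner_self_eq_norm_sq]
    exact inner_sampleCov Y u v
  have h2 := Finset.sum_mul_sq_le_sq_mul_sq Finset.univ
    (fun i => inner ℝ (Y i - sampleMean Y) u) (fun i => inner ℝ (Y i - sampleMean Y) v)
  have h3 : (‖u‖ ^ 2) ^ 2 ≤ (h * ‖u‖ ^ 2) * (h * ‖v‖ ^ 2) := by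
    rw [h1, mul_pow]
    rw [← h1]
    calc _ ≤ ((n : ℝ)⁻¹) ^ 2 * _ := mul_le_mul_of_nonneg_left h2 (by positivity)
      _ = ((n : ℝ)⁻¹ * ∑ i, inner ℝ (Y i - sampleMean Y) u ^ 2) *
          ((n : ℝ)⁻¹ * ∑ i, inner ℝ (Y i - sampleMean Y) v ^ 2) := by ring
      _ ≤ _ := mul_le_mul (hc u) (hc v)
          (mul_nonneg (by positivity) (Finset.sum_nonneg fun i _ => sq_nonneg _)) (by positivity)
  rcases (norm_nonneg u).eq_or_lt with h' | h'
  · rw [← h']; positivity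
  · have h4 : ‖u‖ ^ 2 ≤ (h * ‖v‖) ^ 2 := by
      refine le_of_mul_le_mul_right (a := ‖u‖ ^ 2) ?_ (by positivity)
      calc _ = (‖u‖ ^ 2) ^ 2 := by ring
        _ ≤ _ := h3
        _ = _ := by ring
    exact (pow_le_pow_iff_left₀ h'.le (by positivity) two_ne_zero).1 h4

end Covariance

/-! ### The output of the reduction -/

section Output

variable {n d : ℕ} (f : (Fin n → EuclideanSpace ℝ (Fin d)) → ℝ → EuclideanSpace ℝ (Fin d))
  (T : (Fin n → EuclideanSpace ℝ (Fin d)) → ℝ → ℕ)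

theorem sqrt_sum_mul_self (y : EuclideanSpace ℝ (Fin d)) : √(∑ k, y k * y k) = ‖y‖ := by
  rw [EuclideanSpace.norm_eq]
  simp [sq]

theorem sum_mul_eq_inner (x y : EuclideanSpace ℝ (Fin d)) :
    ∑ k, x k * y k = inner ℝ x y := by
  rw [PiLp.inner_apply]
  simp [mul_comm]

theorem unitVec_smul {c : ℝ} (hc : 0 < c) {b y : EuclideanSpace ℝ (Fin d)} (hb : ‖b‖ = 1)
    (hy : y = c • b) : Reduction.unitVec (fun k => y k) = fun k => b k := by
  subst hy
  ext k
  rw [Reduction.unitVec, sqrt_sum_mul_self, norm_smul, hb, Real.norm_of_nonneg hc.le]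
  simp [hc.ne']

theorem scoreOf_eq (Y : Fin n → EuclideanSpace ℝ (Fin d)) (s : ℝ) (i : Fin n) :
    Reduction.scoreOf (fun Z t k => f (fun i => WithLp.toLp 2 (Z i)) t k) (fun i k => Y i k) s i =
      inner ℝ (sampleMean Y - f Y s) (Y i) / ‖Y i‖ := by
  rw [Reduction.scoreOf, ← sum_mul_eq_inner, Finset.sum_div]
  refine Finset.sum_congr rfl fun k _ => ?_
  rw [Reduction.unitVec, sqrt_sum_mul_self]
  have h1 : (sampleMean Y - f Y s) k = (∑ i, Y i k) / n - f Y s k := by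
    simp [sampleMean, div_eq_inv_mul]
  rw [h1, mul_div_assoc]

variable {f T}

/-- Vectors of one group are positive multiples of one unit vector, hence never orthogonal; vectors
of different groups always are. So the search stops in the other group, and the fallback to the last
entry is not used. -/
theorem unitVec_sub_of_first_mem {Y : Fin n → EuclideanSpace ℝ (Fin d)}
    {b₁ b₂ : EuclideanSpace ℝ (Fin d)} (hb₁ : ‖b₁‖ = 1) (hb₂ : ‖b₂‖ = 1)
    (hb : inner ℝ b₁ b₂ = 0) {S₁ S₂ : Finset (Fin n)} (hdisj : Disjoint S₁ S₂)
    (hS₂ : S₂.Nonempty) (h₁ : ∀ i ∈ S₁, ∃ c : ℝ, 0 < c ∧ Y i = c • b₁)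
    (h₂ : ∀ i ∈ S₂, ∃ c : ℝ, 0 < c ∧ Y i = c • b₂) {i : Fin n} {is : List (Fin n)}
    (hi : i ∈ S₁) (his : ∀ j, j ∈ i :: is ↔ j ∈ S₁ ∪ S₂) :
    (fun k => Reduction.unitVec (fun k => Y i k) k - Reduction.unitVec (fun k => Y
      ((is.find? (fun j => decide (∑ k, Y i k * Y j k = 0))).getD (is.getLastD i)) k) k) =
      fun k => (b₁ - b₂) k := by
  obtain ⟨c, hc, hYi⟩ := h₁ i hi
  obtain ⟨j₀, hj₀⟩ := hS₂
  have hj₀is : j₀ ∈ is := by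
    have := (his j₀).2 (Finset.mem_union_right _ hj₀)
    rcases List.mem_cons.1 this with rfl | h
    · exact absurd hj₀ (Finset.disjoint_left.1 hdisj hi)
    · exact h
  have hsome : (is.find? (fun j => decide (∑ k, Y i k * Y j k = 0))).isSome := by
    rw [List.find?_isSome]
    obtain ⟨c', -, hYj⟩ := h₂ j₀ hj₀
    refine ⟨j₀, hj₀is, ?_⟩
    rw [decide_eq_true_iff, sum_mul_eq_inner, hYi, hYj, real_inner_smul_left,
      real_inner_smul_right, hb]
    ring
  obtain ⟨j, hj⟩ := Option.isSome_iff_exists.1 hsome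
  have hjis := List.mem_of_find?_eq_some hj
  have hj0 := List.find?_some hj
  rw [decide_eq_true_iff, sum_mul_eq_inner] at hj0
  have hjS₂ : j ∈ S₂ := by
    rcases Finset.mem_union.1 ((his j).1 (List.mem_cons_of_mem _ hjis)) with h | h
    · obtain ⟨c', hc', hYj⟩ := h₁ j h
      rw [hYi, hYj, real_inner_smul_left, real_inner_smul_right, real_inner_self_eq_norm_sq,
        hb₁] at hj0
      have : 0 < c * (c' * 1 ^ 2) := by positivity
      linarith
    · exact h
  obtain ⟨c', hc', hYj⟩ := h₂ j hjS₂
  rw [hj, Option.getD_some, unitVec_smul hc hb₁ hYi, unitVec_smul hc' hb₂ hYj]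
  rfl

/-- The score gap makes the selection exactly S₁ ∪ S₂; the group of its leading vector decides the
sign. -/
theorem reductionOutput_eq {Y : Fin n → EuclideanSpace ℝ (Fin d)} {s : ℝ}
    {b₁ b₂ : EuclideanSpace ℝ (Fin d)} (hb₁ : ‖b₁‖ = 1) (hb₂ : ‖b₂‖ = 1)
    (hb : inner ℝ b₁ b₂ = 0) {S₁ S₂ : Finset (Fin n)} (hdisj : Disjoint S₁ S₂)
    (hS₁ : S₁.Nonempty) (hS₂ : S₂.Nonempty) (h₁ : ∀ i ∈ S₁, ∃ c : ℝ, 0 < c ∧ Y i = c • b₁)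
    (h₂ : ∀ i ∈ S₂, ∃ c : ℝ, 0 < c ∧ Y i = c • b₂)
    (hscore : ∀ i ∈ S₁ ∪ S₂, ∀ j ∉ S₁ ∪ S₂, inner ℝ (sampleMean Y - f Y s) (Y j) / ‖Y j‖ <
      inner ℝ (sampleMean Y - f Y s) (Y i) / ‖Y i‖) :
    reductionOutput f T (S₁.card + S₂.card) Y s = b₁ - b₂ ∨
      reductionOutput f T (S₁.card + S₂.card) Y s = b₂ - b₁ := by
  obtain ⟨J, hJ, hJs, hout⟩ := Reduction.run_algorithm_fst
    (fun Z t k => f (fun i => WithLp.toLp 2 (Z i)) t k)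
    (fun Z t => T (fun i => WithLp.toLp 2 (Z i)) t) (S₁.card + S₂.card) (fun i k => Y i k) s
  simp only [scoreOf_eq] at hJs
  have hmem := mem_take_iff_of_score_lt hJ hJs hscore
  rw [Finset.card_union_of_disjoint hdisj] at hmem
  obtain ⟨i, is, his⟩ : ∃ i is, J.take (S₁.card + S₂.card) = i :: is := by
    obtain ⟨i, hi⟩ := hS₁
    exact List.exists_cons_of_ne_nil
      (List.ne_nil_of_mem ((hmem i).2 (Finset.mem_union_left _ hi)))
  have hout := hout i is his
  rw [his] at hmem
  have hre : ∀ b : EuclideanSpace ℝ (Fin d),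
      ((Reduction.algorithm (S₁.card + S₂.card) (fun i k => Y i k) s).run
        (fun Z t k => f (fun i => WithLp.toLp 2 (Z i)) t k)
        (fun Z t => T (fun i => WithLp.toLp 2 (Z i)) t)).1 = (fun k => b k) →
      reductionOutput f T (S₁.card + S₂.card) Y s = b := by
    intro b h
    rw [reductionOutput, runReduction, h]
  rcases Finset.mem_union.1 ((hmem i).1 List.mem_cons_self) with hi | hi
  · exact Or.inl (hre _ (hout.trans
      (unitVec_sub_of_first_mem hb₁ hb₂ hb hdisj hS₂ h₁ h₂ hi hmem)))
  · refine Or.inr (hre _ (hout.trans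
      (unitVec_sub_of_first_mem hb₂ hb₁ ?_ hdisj.symm hS₁ h₂ h₁ hi ?_)))
    · rw [real_inner_comm]; exact hb
    · rw [Finset.union_comm]; exact hmem

/-- An angle between lines: |⟨w, v⟩|/√2 ≥ √(1 - t), and the sign of ⟨w, v⟩ selects v or -v. For t >
1 the root is 0 and the bound is a right angle. -/
theorem angle_le_or_angle_neg_le {E : Type*} [NormedAddCommGroup E] [InnerProductSpace ℝ E]
    {D w v : E} (hD : ‖D‖ ^ 2 = 2) (hw : w = D ∨ w = -D) (hv : ‖v‖ = 1) {t : ℝ}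
    (h : 1 - inner ℝ D v ^ 2 / 2 ≤ t) :
    InnerProductGeometry.angle w v ≤ Real.arccos √(1 - t) ∨
      InnerProductGeometry.angle w (-v) ≤ Real.arccos √(1 - t) := by
  have hDn : ‖D‖ = √2 := by rw [← hD, Real.sqrt_sq (norm_nonneg _)]
  have hwn : ‖w‖ = √2 := by rcases hw with rfl | rfl <;> simp [hDn]
  have hwv : inner ℝ w v ^ 2 = inner ℝ D v ^ 2 := by
    rcases hw with rfl | rfl <;> simp [inner_neg_left]
  have hle : √(1 - t) ≤ |inner ℝ w v / √2| := by
    rw [← Real.sqrt_sq_eq_abs, div_pow, hwv, Real.sq_sqrt (by norm_num)]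
    exact Real.sqrt_le_sqrt (by linarith)
  rcases le_abs.1 hle with h' | h'
  · left
    rw [InnerProductGeometry.angle, hwn, hv, mul_one]
    exact Real.arccos_le_arccos h'
  · right
    rw [InnerProductGeometry.angle, hwn, norm_neg, hv, mul_one, inner_neg_right, neg_div]
    exact Real.arccos_le_arccos h'

end Output

/-! ### Correctness for typical samples -/

section Typical

variable {n d : ℕ}

/-- The typical behaviour of a standard Gaussian sample `x`, of which the vectors with index in `G`
are kept, with respect to the directions `b₁` and `b₂`. -/
structure IsTypical (η : ℝ) (G : Finset (Fin n)) (b₁ b₂ : EuclideanSpace ℝ (Fin d))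
    (x : Fin n → EuclideanSpace ℝ (Fin d)) : Prop where
  le_norm : ∀ i, d / 2 ≤ ‖x i‖ ^ 2
  norm_le : ∀ i, ‖x i‖ ^ 2 ≤ 2 * d
  inner_le : ∀ i j, i ≠ j → |inner ℝ (x i) (x j)| ≤ η * d
  inner_dir_le : ∀ i, |inner ℝ (x i) (b₁ + b₂)| ≤ √d / 4
  sum_inner_le : |∑ i ∈ G, inner ℝ (x i) (b₁ - b₂)| ≤ 2 * √(d * n)
  sum_inner_mul_le : d ≤ n → ∀ k,
    |∑ i ∈ G, inner ℝ (x i) (b₁ - b₂) * x i k - G.card * (b₁ - b₂) k| ≤ 4 * √(d * n)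
  sum_inner_sq_le : n ≤ d → ∑ i ∈ G, inner ℝ (x i) (b₁ - b₂) ^ 2 ≤ 4 * d

namespace IsTypical

variable {η : ℝ} {G : Finset (Fin n)} {b₁ b₂ : EuclideanSpace ℝ (Fin d)}
  {x : Fin n → EuclideanSpace ℝ (Fin d)}

/-- The condition 2 ≤ ηn lets the diagonal term 2d be absorbed into ηdn. -/
theorem sum_inner_sq_le_mul (h : IsTypical η G b₁ b₂ x) (hη : 0 ≤ η) (hn : 2 ≤ η * n)
    (S : Finset (Fin n)) (v : EuclideanSpace ℝ (Fin d)) :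
    ∑ i ∈ S, inner ℝ (x i) v ^ 2 ≤ 2 * η * d * n * ‖v‖ ^ 2 := by
  refine (_root_.sum_inner_sq_le (by positivity) (by positivity) h.norm_le h.inner_le v).trans ?_
  have hS : (S.card : ℝ) ≤ n := by exact_mod_cast (S.card_le_univ).trans_eq (by simp)
  have hd : (0 : ℝ) ≤ d := by positivity
  refine mul_le_mul_of_nonneg_right ?_ (sq_nonneg _)
  have h1 : η * d * S.card ≤ η * d * n := by gcongr
  nlinarith

theorem norm_sum_sq_le (h : IsTypical η G b₁ b₂ x) (hη : 0 ≤ η) (hn : 2 ≤ η * n)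
    (S : Finset (Fin n)) : ‖∑ i ∈ S, x i‖ ^ 2 ≤ 2 * η * d * n ^ 2 := by
  have h1 := norm_sum_smul_sq_le (S := S) (by positivity) h.norm_le h.inner_le (fun _ => 1)
  have hS : (S.card : ℝ) ≤ n := by exact_mod_cast (S.card_le_univ).trans_eq (by simp)
  have hd : (0 : ℝ) ≤ d := by positivity
  simp only [one_smul, one_pow, Finset.sum_const, nsmul_eq_mul, mul_one] at h1
  refine h1.trans ?_
  have h2 : η * d * S.card ≤ η * d * n := by gcongr
  calc (2 * d + η * d * S.card) * S.card ≤ (η * n * d + η * d * n) * n := by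
        gcongr
    _ = _ := by ring

theorem norm_mean_le (h : IsTypical η G b₁ b₂ x) (hη : 0 ≤ η) (hn : 2 ≤ η * n)
    (S : Finset (Fin n)) : ‖(n : ℝ)⁻¹ • ∑ i ∈ S, x i‖ ≤ √(2 * η * d) := by
  have h1 := h.norm_sum_sq_le hη hn S
  have hn0 : (0 : ℝ) < n := by
    rcases (Nat.cast_nonneg (α := ℝ) n).eq_or_lt with h0 | h0
    · rw [← h0] at hn; norm_num at hn
    · exact h0
  apply Real.le_sqrt_of_sq_le
  rw [norm_smul, mul_pow, Real.norm_of_nonneg (by positivity), inv_pow, inv_mul_le_iff₀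
    (by positivity)]
  linarith

/-- A bound of order ηd is enough, since the resulting bias is only compared with ε√d. -/
theorem norm_sampleCov_le (h : IsTypical η G b₁ b₂ x) (hη : 0 ≤ η) (hn : 2 ≤ η * n) :
    ‖sampleCov x‖ ≤ 2 * η * d := by
  have hn0 : (0 : ℝ) < n := by
    rcases (Nat.cast_nonneg (α := ℝ) n).eq_or_lt with h0 | h0
    · rw [← h0] at hn; norm_num at hn
    · exact h0
  refine _root_.norm_sampleCov_le (by exact_mod_cast hn0) x (by positivity) fun v => ?_
  rw [inv_mul_le_iff₀ hn0]
  refine (h.sum_inner_sq_le_mul hη hn _ v).trans (le_of_eq (by ring))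

/-- The covariance of the kept vectors nearly has the eigenvector `b₁ - b₂`. -/
theorem abs_sum_inner_mul_inner_le (h : IsTypical η G b₁ b₂ x) {u : EuclideanSpace ℝ (Fin d)}
    (hu : inner ℝ (b₁ - b₂) u = 0) :
    |∑ i ∈ G, inner ℝ (x i) u * inner ℝ (x i) (b₁ - b₂)| ≤ 4 * (d * √n) * ‖u‖ := by
  set D := b₁ - b₂ with hD
  have hd0 : (0 : ℝ) ≤ d := by positivity
  have hn0 : (0 : ℝ) ≤ n := by positivity
  -- For d ≤ n, each of the d coordinates of ∑ ⟨xᵢ, D⟩ xᵢ - |G| D is at most 4√(dn), which gives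
  -- norm 4d√n. For n ≤ d, Cauchy–Schwarz suffices: ∑ ⟨xᵢ, D⟩² ≤ 4d and ∑ ⟨xᵢ, u⟩² ≤ 2dn‖u‖².
  rcases le_total d n with hdn | hnd
  · set w : EuclideanSpace ℝ (Fin d) :=
      ∑ i ∈ G, inner ℝ (x i) D • x i - (G.card : ℝ) • D with hw
    have h1 : ∑ i ∈ G, inner ℝ (x i) u * inner ℝ (x i) D = inner ℝ w u := by
      rw [hw, inner_sub_left, real_inner_smul_left, hu, sum_inner, mul_zero, sub_zero]
      refine Finset.sum_congr rfl fun i _ => ?_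
      rw [real_inner_smul_left, mul_comm]
    have h2 : ‖w‖ ^ 2 ≤ (4 * (d * √n)) ^ 2 := by
      rw [EuclideanSpace.real_norm_sq_eq]
      calc ∑ k, w k ^ 2 ≤ ∑ _k : Fin d, (4 * √(d * n)) ^ 2 := by
            refine Finset.sum_le_sum fun k _ => sq_le_sq' ?_ ?_
            · have := h.sum_inner_mul_le hdn k
              rw [← hD] at this
              have hwk : w k = ∑ i ∈ G, inner ℝ (x i) D * x i k - G.card * D k := by
                simp [hw]
              rw [hwk]
              exact (abs_le.1 this).1
            · have := h.sum_inner_mul_le hdn k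
              rw [← hD] at this
              have hwk : w k = ∑ i ∈ G, inner ℝ (x i) D * x i k - G.card * D k := by
                simp [hw]
              rw [hwk]
              exact (abs_le.1 this).2
        _ = d * (16 * (d * n)) := by
            rw [Finset.sum_const, Finset.card_univ, Fintype.card_fin, nsmul_eq_mul, mul_pow,
              Real.sq_sqrt (by positivity)]
            norm_num
        _ = _ := by
            rw [mul_pow, mul_pow, Real.sq_sqrt hn0]; ring
    have h3 : ‖w‖ ≤ 4 * (d * √n) :=
      (pow_le_pow_iff_left₀ (norm_nonneg _) (by positivity) two_ne_zero).1 h2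
    rw [h1]
    exact (abs_real_inner_le_norm w u).trans (mul_le_mul_of_nonneg_right h3 (norm_nonneg _))
  · have h1 := h.sum_inner_sq_le hnd
    rw [← hD] at h1
    have h2 := Finset.sum_mul_sq_le_sq_mul_sq G (fun i => inner ℝ (x i) u)
      (fun i => inner ℝ (x i) D)
    have h3 : ∑ i ∈ G, inner ℝ (x i) u ^ 2 ≤ 2 * d * n * ‖u‖ ^ 2 := by
      calc ∑ i ∈ G, inner ℝ (x i) u ^ 2 ≤ ∑ _i ∈ G, 2 * d * ‖u‖ ^ 2 := by
            refine Finset.sum_le_sum fun i _ => ?_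
            have h4 := real_inner_mul_inner_self_le (x i) u
            rw [real_inner_self_eq_norm_sq, real_inner_self_eq_norm_sq, ← sq] at h4
            exact h4.trans (mul_le_mul_of_nonneg_right (h.norm_le i) (sq_nonneg _))
        _ = G.card * (2 * d * ‖u‖ ^ 2) := by rw [Finset.sum_const, nsmul_eq_mul]
        _ ≤ n * (2 * d * ‖u‖ ^ 2) := by
            have hS : (G.card : ℝ) ≤ n := by exact_mod_cast (G.card_le_univ).trans_eq (by simp)
            gcongr
        _ = _ := by ring
    apply abs_le_of_sq_le_sq
    · refine h2.trans ((mul_le_mul h3 h1 (Finset.sum_nonneg fun i _ => sq_nonneg _)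
        (by positivity)).trans ?_)
      have : (4 * (d * √n) * ‖u‖) ^ 2 = 16 * d ^ 2 * n * ‖u‖ ^ 2 := by
        rw [mul_pow, mul_pow, mul_pow, Real.sq_sqrt hn0]; ring
      rw [this]
      have : 0 ≤ (d : ℝ) ^ 2 * n * ‖u‖ ^ 2 := by positivity
      nlinarith
    · positivity

end IsTypical

/-! ### The corrupted samples -/

theorem sum_corrupted {S₁ S₂ : Finset (Fin n)} (hS : Disjoint S₁ S₂) (l : Fin n → ℝ)
    (b₁ b₂ : EuclideanSpace ℝ (Fin d)) (x : Fin n → EuclideanSpace ℝ (Fin d))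
    {V : Type*} [AddCommMonoid V] (g : EuclideanSpace ℝ (Fin d) → V) :
    ∑ i, g (corrupted S₁ S₂ l b₁ b₂ x i) = ∑ i ∈ (S₁ ∪ S₂)ᶜ, g (x i) +
      (∑ i ∈ S₁, g ((√(d : ℝ) + l i) • b₁) + ∑ i ∈ S₂, g ((√(d : ℝ) + l i) • b₂)) := by
  rw [← Finset.sum_compl_add_sum (S₁ ∪ S₂), Finset.sum_union hS]
  congr 1
  · refine Finset.sum_congr rfl fun i hi => ?_
    rw [Finset.mem_compl, Finset.mem_union, not_or] at hi
    rw [corrupted, if_neg hi.1, if_neg hi.2]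
  · congr 1
    · refine Finset.sum_congr rfl fun i hi => ?_
      rw [corrupted, if_pos hi]
    · refine Finset.sum_congr rfl fun i hi => ?_
      rw [corrupted, if_neg (Finset.disjoint_right.1 hS hi), if_pos hi]

variable {ε : ℝ} {S₁ S₂ : Finset (Fin n)} {l : Fin n → ℝ}

theorem IsPlacement.sampleMean_corrupted (h : IsPlacement d ε S₁ S₂ l) (hn : 0 < n)
    (b₁ b₂ : EuclideanSpace ℝ (Fin d)) (x : Fin n → EuclideanSpace ℝ (Fin d)) :
    sampleMean (corrupted S₁ S₂ l b₁ b₂ x) =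
      (n : ℝ)⁻¹ • ∑ i ∈ (S₁ ∪ S₂)ᶜ, x i + (ε * √d / 2) • (b₁ + b₂) := by
  have hn' : (n : ℝ) ≠ 0 := by positivity
  have h1 := sum_corrupted h.disjoint l b₁ b₂ x (fun y => y)
  rw [sampleMean, h1, smul_add]
  congr 1
  rw [← Finset.sum_smul, ← Finset.sum_smul, Finset.sum_add_distrib, Finset.sum_add_distrib,
    h.sum_fst, h.sum_snd, Finset.sum_const, Finset.sum_const, nsmul_eq_mul, nsmul_eq_mul,
    h.card_fst, h.card_snd, add_zero, ← smul_add, smul_smul]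
  congr 1
  field_simp

/-- The variance of the corrupted vectors along each of the two directions, before centering. -/
noncomputable def placementVariance (d : ℕ) (ε : ℝ) (S₁ : Finset (Fin n)) (l : Fin n → ℝ) : ℝ :=
  ε * d / 2 + (n : ℝ)⁻¹ * ∑ i ∈ S₁, l i ^ 2

/-- Equal sums of squared offsets give b₁ and b₂ the same second moment, so only the centering term
distinguishes b₁ + b₂ from b₁ - b₂ in the placed part. -/
theorem IsPlacement.inner_sampleCov_corrupted (h : IsPlacement d ε S₁ S₂ l) (hn : 0 < n)
    (b₁ b₂ : EuclideanSpace ℝ (Fin d)) (x : Fin n → EuclideanSpace ℝ (Fin d))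
    (u v : EuclideanSpace ℝ (Fin d)) :
    inner ℝ u (sampleCov (corrupted S₁ S₂ l b₁ b₂ x) v) =
      (n : ℝ)⁻¹ * ∑ i ∈ (S₁ ∪ S₂)ᶜ, inner ℝ (x i) u * inner ℝ (x i) v +
      placementVariance d ε S₁ l * (inner ℝ b₁ u * inner ℝ b₁ v + inner ℝ b₂ u * inner ℝ b₂ v) -
      (inner ℝ ((n : ℝ)⁻¹ • ∑ i ∈ (S₁ ∪ S₂)ᶜ, x i) u + ε * √d / 2 * inner ℝ (b₁ + b₂) u) *
      (inner ℝ ((n : ℝ)⁻¹ • ∑ i ∈ (S₁ ∪ S₂)ᶜ, x i) v + ε * √d / 2 * inner ℝ (b₁ + b₂) v) := by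
  have hn' : (n : ℝ) ≠ 0 := by positivity
  rw [inner_sampleCov_eq hn, h.sampleMean_corrupted hn, inner_add_left, inner_add_left,
    real_inner_smul_left (b₁ + b₂), real_inner_smul_left (b₁ + b₂)]
  congr 1
  rw [sum_corrupted h.disjoint l b₁ b₂ x (fun y => inner ℝ y u * inner ℝ y v), mul_add]
  congr 1
  have key : ∀ (S : Finset (Fin n)) (b : EuclideanSpace ℝ (Fin d)), (S.card : ℝ) = ε * n / 2 →
      ∑ i ∈ S, l i = 0 → ∑ i ∈ S, inner ℝ ((√(d : ℝ) + l i) • b) u *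
        inner ℝ ((√(d : ℝ) + l i) • b) v =
      (ε * n / 2 * d + ∑ i ∈ S, l i ^ 2) * (inner ℝ b u * inner ℝ b v) := by
    intro S b hS hl
    have : ∀ i ∈ S, inner ℝ ((√(d : ℝ) + l i) • b) u * inner ℝ ((√(d : ℝ) + l i) • b) v =
        (d + 2 * √d * l i + l i ^ 2) * (inner ℝ b u * inner ℝ b v) := by
      intro i _
      rw [real_inner_smul_left, real_inner_smul_left]
      have : √(d : ℝ) ^ 2 = d := Real.sq_sqrt (by positivity)
      linear_combination (inner ℝ b u * inner ℝ b v) * this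
    rw [Finset.sum_congr rfl this, ← Finset.sum_mul, Finset.sum_add_distrib,
      Finset.sum_add_distrib, ← Finset.mul_sum, hl, Finset.sum_const, nsmul_eq_mul, hS]
    ring
  rw [key S₁ b₁ h.card_fst h.sum_fst, key S₂ b₂ h.card_snd h.sum_snd, ← h.sum_sq,
    placementVariance]
  field_simp

theorem IsPlacement.isCorruption (h : IsPlacement d ε S₁ S₂ l)
    (b₁ b₂ : EuclideanSpace ℝ (Fin d)) (x : Fin n → EuclideanSpace ℝ (Fin d)) :
    IsCorruption ε x (corrupted S₁ S₂ l b₁ b₂ x) := by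
  classical
  have h1 : (Finset.univ.filter (fun i => corrupted S₁ S₂ l b₁ b₂ x i ≠ x i)) ⊆ S₁ ∪ S₂ := by
    intro i hi
    by_contra hc
    rw [Finset.mem_union, not_or] at hc
    rw [Finset.mem_filter, corrupted, if_neg hc.1, if_neg hc.2] at hi
    exact hi.2 rfl
  have h2 := Finset.card_le_card h1
  rw [Finset.card_union_of_disjoint h.disjoint] at h2
  have h3 : ((Finset.univ.filter (fun i => corrupted S₁ S₂ l b₁ b₂ x i ≠ x i)).card : ℝ) ≤
      S₁.card + S₂.card := by exact_mod_cast h2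
  rw [h.card_fst, h.card_snd] at h3
  unfold IsCorruption
  convert h3 using 1
  ring

/-- The resolution at which the kept Gaussian vectors have to be nearly orthogonal. -/
noncomputable def resolution (ε τ : ℝ) : ℝ := ε ^ 2 / (1000 * (1 + τ) ^ 2)

theorem resolution_pos {ε τ : ℝ} (hε : 0 < ε) (hτ : 0 ≤ τ) : 0 < resolution ε τ := by
  unfold resolution; positivity

theorem resolution_le {ε τ : ℝ} (hτ : 0 ≤ τ) : resolution ε τ ≤ ε ^ 2 / 1000 := by
  unfold resolution
  apply div_le_div_of_nonneg_left (sq_nonneg _) (by norm_num)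
  nlinarith

/-- The factor 1 + τ collects the aggregator's bias and the contribution of the replaced vectors to
the mean; the constant 1000 enters through 2/1000 ≤ 1/400. -/
theorem mul_sqrt_resolution_le {ε τ : ℝ} (hε : 0 < ε) (hτ : 0 ≤ τ) :
    (1 + τ) * √(2 * resolution ε τ * d) ≤ ε * √d / 20 := by
  have h1 : 2 * resolution ε τ * d ≤ (ε * √d / 20 / (1 + τ)) ^ 2 := by
    have : (ε * √d / 20 / (1 + τ)) ^ 2 = ε ^ 2 * d / (400 * (1 + τ) ^ 2) := by
      rw [div_pow, div_pow, mul_pow, Real.sq_sqrt (by positivity)]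
      field_simp
      norm_num
    rw [this, resolution]
    have h2 : 2 * (ε ^ 2 / (1000 * (1 + τ) ^ 2)) * d = ε ^ 2 * d / (500 * (1 + τ) ^ 2) := by
      field_simp
      ring
    rw [h2]
    gcongr
    norm_num
  have h3 := Real.sqrt_le_sqrt h1
  rw [Real.sqrt_sq (by positivity), le_div_iff₀ (by positivity)] at h3
  linarith

/-- In units of ε√d, corrupted vectors score at least 1/2 - 1/20. The others score at most 1/4 +
1/20, since ⟨xⱼ, b₁+b₂⟩ ≤ √d/4 and ‖xⱼ‖ ≥ √d/2. -/
theorem IsTypical.score_lt {τ : ℝ} (hε : 0 < ε) (hε1 : ε < 1 / 2) (hτ : 0 ≤ τ) (hd : 0 < d)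
    (hn : 2 ≤ resolution ε τ * n) {b₁ b₂ : EuclideanSpace ℝ (Fin d)} (hb₁ : ‖b₁‖ = 1)
    (hb₂ : ‖b₂‖ = 1) (hb : inner ℝ b₁ b₂ = 0) (hp : IsPlacement d ε S₁ S₂ l)
    {x : Fin n → EuclideanSpace ℝ (Fin d)} (h : IsTypical (resolution ε τ) (S₁ ∪ S₂)ᶜ b₁ b₂ x)
    {f : (Fin n → EuclideanSpace ℝ (Fin d)) → ℝ → EuclideanSpace ℝ (Fin d)}
    (hf : IsStrongRobustAggregator ε τ f) :
    let Y := corrupted S₁ S₂ l b₁ b₂ x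
    let w := sampleMean Y - f Y ‖sampleCov x‖
    ∀ i ∈ S₁ ∪ S₂, ∀ j ∉ S₁ ∪ S₂, inner ℝ w (Y j) / ‖Y j‖ < inner ℝ w (Y i) / ‖Y i‖ := by
  intro Y w i hi j hj
  have hη := resolution_pos hε hτ
  have hn0 : 0 < n := by
    rcases Nat.eq_zero_or_pos n with h0 | h0
    · rw [h0] at hn; norm_num at hn
    · exact h0
  have hd' : (0 : ℝ) < d := by exact_mod_cast hd
  have hsd : 0 < √(d : ℝ) := Real.sqrt_pos.2 hd'
  set r := w - (ε * √d / 2) • (b₁ + b₂) with hr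
  have hw : w = (ε * √d / 2) • (b₁ + b₂) + r := by rw [hr]; abel
  have hrn : ‖r‖ ≤ ε * √d / 20 := by
    -- The kept vectors contribute equally to both means, so only the aggregator's error and the
    -- replaced vectors remain.
    have h1 : r = (sampleMean x - f Y ‖sampleCov x‖) - (n : ℝ)⁻¹ • ∑ i ∈ S₁ ∪ S₂, x i := by
      have h2 : sampleMean x = (n : ℝ)⁻¹ • ∑ i ∈ (S₁ ∪ S₂)ᶜ, x i +
          (n : ℝ)⁻¹ • ∑ i ∈ S₁ ∪ S₂, x i := by
        rw [sampleMean, ← Finset.sum_compl_add_sum (S₁ ∪ S₂), smul_add]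
      rw [hr, h2]
      simp only [w, Y]
      rw [hp.sampleMean_corrupted hn0]
      abel
    have h2 := hf x Y (hp.isCorruption b₁ b₂ x)
    have h3 := h.norm_mean_le hη.le hn (S₁ ∪ S₂)
    have h4 : √‖sampleCov x‖ ≤ √(2 * resolution ε τ * d) :=
      Real.sqrt_le_sqrt (h.norm_sampleCov_le hη.le hn)
    have h5 : √ε ≤ 1 := Real.sqrt_le_one.2 (by linarith)
    have h6 := mul_sqrt_resolution_le (d := d) hε hτ
    rw [norm_sub_rev] at h2
    calc ‖r‖ ≤ ‖sampleMean x - f Y ‖sampleCov x‖‖ + ‖(n : ℝ)⁻¹ • ∑ i ∈ S₁ ∪ S₂, x i‖ := by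
          rw [h1]; exact norm_sub_le _ _
      _ ≤ τ * 1 * √(2 * resolution ε τ * d) + √(2 * resolution ε τ * d) := by
          refine add_le_add (h2.trans ?_) h3
          gcongr
      _ = (1 + τ) * √(2 * resolution ε τ * d) := by ring
      _ ≤ _ := h6
  have hhigh : ∀ (b : EuclideanSpace ℝ (Fin d)) (c : ℝ), ‖b‖ = 1 → inner ℝ (b₁ + b₂) b = 1 →
      0 < c → ε * √d / 2 - ε * √d / 20 ≤ inner ℝ w (c • b) / ‖c • b‖ := by
    intro b c hb1 hbb hc
    rw [norm_smul, hb1, real_inner_smul_right, Real.norm_of_nonneg hc.le, mul_one,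
      mul_div_cancel_left₀ _ hc.ne', hw, inner_add_left, real_inner_smul_left, hbb]
    have := abs_le.1 ((abs_real_inner_le_norm r b).trans (by rw [hb1, mul_one]; exact hrn :
      ‖r‖ * ‖b‖ ≤ ε * √d / 20))
    linarith [this.1]
  have hpos : ∀ i ∈ S₁ ∪ S₂, 0 < √(d : ℝ) + l i := fun i hi => by
    have := abs_lt.1 (hp.abs_lt i hi)
    linarith [this.1]
  have hi' : ε * √d / 2 - ε * √d / 20 ≤ inner ℝ w (Y i) / ‖Y i‖ := by
    by_cases hi1 : i ∈ S₁
    · have : Y i = (√(d : ℝ) + l i) • b₁ := by simp only [Y]; rw [corrupted, if_pos hi1]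
      rw [this]
      refine hhigh b₁ _ hb₁ ?_ (hpos i hi)
      rw [inner_add_left, real_inner_self_eq_norm_sq, hb₁, real_inner_comm, hb]; norm_num
    · have hi2 : i ∈ S₂ := (Finset.mem_union.1 hi).resolve_left hi1
      have : Y i = (√(d : ℝ) + l i) • b₂ := by
        simp only [Y]; rw [corrupted, if_neg hi1, if_pos hi2]
      rw [this]
      refine hhigh b₂ _ hb₂ ?_ (hpos i hi)
      rw [inner_add_left, real_inner_self_eq_norm_sq, hb₂, hb]; norm_num
  have hj' : inner ℝ w (Y j) / ‖Y j‖ ≤ ε * √d / 4 + ε * √d / 20 := by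
    have hYj : Y j = x j := by
      rw [Finset.mem_union, not_or] at hj
      simp only [Y]; rw [corrupted, if_neg hj.1, if_neg hj.2]
    rw [hYj]
    have h1 : √d / 2 ≤ ‖x j‖ := by
      apply (pow_le_pow_iff_left₀ (by positivity) (norm_nonneg _) two_ne_zero).1
      refine le_trans ?_ (h.le_norm j)
      rw [div_pow, Real.sq_sqrt hd'.le]
      linarith
    have h0 : 0 < ‖x j‖ := lt_of_lt_of_le (by positivity) h1
    rw [div_le_iff₀ h0, hw, inner_add_left, real_inner_smul_left, real_inner_comm, add_mul]
    refine add_le_add ?_ ((real_inner_le_norm _ _).trans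
      (mul_le_mul_of_nonneg_right hrn h0.le))
    have h2 := (abs_le.1 (h.inner_dir_le j)).2
    calc ε * √d / 2 * inner ℝ (x j) (b₁ + b₂) ≤ ε * √d / 2 * (√d / 4) := by gcongr
      _ = ε * √d / 4 * (√d / 2) := by ring
      _ ≤ _ := by gcongr
  have : 0 < ε * √d := by positivity
  linarith

/-- The spectral gap. Centering turns σ · 2t² into (σ - ε²D/2) · 2t², which is largest at 2t² = U².
The Gaussian part and the cross term lose 1/500 and 1/10 of ε²D, and 1/2 - 1/10 - 1/500 > 1/3. -/
theorem centered_form_le {D η σ A p t U : ℝ} (hε : 0 ≤ ε) (hD : 0 ≤ D) (hη : η ≤ ε ^ 2 / 1000)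
    (hA : A ≤ 2 * η * D * U ^ 2) (hσ : ε ^ 2 * D / 2 ≤ σ) (ht : 2 * t ^ 2 ≤ U ^ 2) (hU : 0 ≤ U)
    (hp : |p| ≤ ε * √D / 20 * U) :
    A + σ * (t * t + t * t) - (p + ε * √D / 2 * (t + t)) * (p + ε * √D / 2 * (t + t)) ≤
      (σ - ε ^ 2 * D / 3) * U ^ 2 := by
  have hsd2 : √D ^ 2 = D := Real.sq_sqrt hD
  have htu : |t| ≤ U := abs_le_of_sq_le_sq (by linarith [sq_nonneg t]) hU
  have hcross : -(2 * (ε * √D) * t * p) ≤ ε ^ 2 * D / 10 * U ^ 2 := by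
    calc -(2 * (ε * √D) * t * p) ≤ |2 * (ε * √D) * t * p| := neg_le_abs _
      _ = 2 * (ε * √D) * (|t| * |p|) := by
          rw [abs_mul, abs_mul, abs_of_nonneg (by positivity)]; ring
      _ ≤ 2 * (ε * √D) * (U * (ε * √D / 20 * U)) := by gcongr
      _ = ε ^ 2 * √D ^ 2 / 10 * U ^ 2 := by ring
      _ = _ := by rw [hsd2]
  have hmain : (σ - ε ^ 2 * D / 2) * (2 * t ^ 2) ≤ (σ - ε ^ 2 * D / 2) * U ^ 2 :=
    mul_le_mul_of_nonneg_left ht (by linarith)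
  have hexp : (p + ε * √D / 2 * (t + t)) * (p + ε * √D / 2 * (t + t)) =
      p ^ 2 + 2 * (ε * √D) * t * p + ε ^ 2 * D * t ^ 2 := by
    linear_combination ε ^ 2 * t ^ 2 * hsd2
  have hηu : η * D * U ^ 2 ≤ ε ^ 2 / 1000 * D * U ^ 2 := by gcongr
  have h0 : 0 ≤ ε ^ 2 * D * U ^ 2 := by positivity
  rw [hexp]
  linarith [sq_nonneg p]

theorem abs_centered_form_le {D N s q p U : ℝ} (hD : 0 ≤ D) (hN : 0 < N)
    (hs : |s| ≤ 4 * (D * √N) * U) (hq : |q| ≤ √D * U) (hp : |p| ≤ 2 * √D / √N) :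
    |N⁻¹ * s - q * p| ≤ 6 * (D / √N) * U := by
  have hsN : 0 < √N := Real.sqrt_pos.2 hN
  have hsd2 : √D ^ 2 = D := Real.sq_sqrt hD
  have hsn2 : √N ^ 2 = N := Real.sq_sqrt hN.le
  calc _ ≤ |N⁻¹ * s| + |q * p| := abs_sub _ _
    _ ≤ N⁻¹ * (4 * (D * √N) * U) + √D * U * (2 * √D / √N) := by
        rw [abs_mul, abs_mul, abs_of_pos (inv_pos.2 hN)]
        refine add_le_add (mul_le_mul_of_nonneg_left hs (inv_pos.2 hN).le)
          (mul_le_mul hq hp (abs_nonneg _) ((abs_nonneg _).trans hq))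
    _ = N⁻¹ * (4 * (D * √N) * U) + 2 * √D ^ 2 * U / √N := by ring
    _ = _ := by
        rw [hsd2]
        nth_rewrite 1 [← hsn2]
        field_simp
        ring

/-- The gap lemma with γ - α ≥ ε²d/4 and β = 6d/√n: the ratio is at most 24/(ε²√n), whose square is
576/(ε⁴n). -/
theorem IsTypical.one_sub_inner_sq_le {τ : ℝ} (hε : 0 < ε) (hε1 : ε < 1 / 2) (hτ : 0 ≤ τ)
    (hd : 0 < d) (hn : 2 ≤ resolution ε τ * n) {b₁ b₂ : EuclideanSpace ℝ (Fin d)} (hb₁ : ‖b₁‖ = 1)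
    (hb₂ : ‖b₂‖ = 1) (hb : inner ℝ b₁ b₂ = 0) (hp : IsPlacement d ε S₁ S₂ l)
    {x : Fin n → EuclideanSpace ℝ (Fin d)} (h : IsTypical (resolution ε τ) (S₁ ∪ S₂)ᶜ b₁ b₂ x)
    {v : EuclideanSpace ℝ (Fin d)}
    (hv : IsMaxVarianceDirection (corrupted S₁ S₂ l b₁ b₂ x) v) :
    1 - inner ℝ (b₁ - b₂) v ^ 2 / 2 ≤ 576 / (ε ^ 4 * n) := by
  have hη := resolution_pos hε hτ
  have hη' := resolution_le (ε := ε) hτ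
  set η := resolution ε τ
  have hn0 : 0 < n := by
    rcases Nat.eq_zero_or_pos n with h0 | h0
    · rw [h0] at hn; norm_num at hn
    · exact h0
  have hn' : (0 : ℝ) < n := by exact_mod_cast hn0
  have hd' : (0 : ℝ) < d := by exact_mod_cast hd
  have hsd : 0 < √(d : ℝ) := Real.sqrt_pos.2 hd'
  have hsn : 0 < √(n : ℝ) := Real.sqrt_pos.2 hn'
  have hsd2 : √(d : ℝ) ^ 2 = d := Real.sq_sqrt hd'.le
  have hsn2 : √(n : ℝ) ^ 2 = n := Real.sq_sqrt hn'.le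
  set z := (n : ℝ)⁻¹ • ∑ i ∈ (S₁ ∪ S₂)ᶜ, x i with hz
  set σ := placementVariance d ε S₁ l with hσ
  have hσge : ε * d / 2 ≤ σ := by
    rw [hσ, placementVariance]
    have : 0 ≤ (n : ℝ)⁻¹ * ∑ i ∈ S₁, l i ^ 2 :=
      mul_nonneg (by positivity) (Finset.sum_nonneg fun i _ => sq_nonneg _)
    linarith
  have hσge' : ε ^ 2 * d / 2 ≤ σ := by
    linarith [mul_nonneg (mul_pos hε hd').le (by linarith : 0 ≤ 1 - ε)]
  have hzn : ‖z‖ ≤ ε * √d / 20 := by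
    have h1 := h.norm_mean_le hη.le hn (S₁ ∪ S₂)ᶜ
    have h2 := mul_sqrt_resolution_le (d := d) hε hτ
    refine h1.trans (le_trans ?_ h2)
    have : 0 ≤ √(2 * η * d) := Real.sqrt_nonneg _
    nlinarith
  have hbb : inner ℝ b₁ b₁ = (1 : ℝ) := by rw [real_inner_self_eq_norm_sq, hb₁]; norm_num
  have hbb' : inner ℝ b₂ b₂ = (1 : ℝ) := by rw [real_inner_self_eq_norm_sq, hb₂]; norm_num
  have hb' : inner ℝ b₂ b₁ = (0 : ℝ) := by rw [real_inner_comm]; exact hb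
  have hD : ‖b₁ - b₂‖ ^ 2 = 2 := by
    rw [norm_sub_sq_real, hb₁, hb₂, hb]; norm_num
  have hDp : ‖b₁ + b₂‖ ^ 2 = 2 := by
    rw [norm_add_sq_real, hb₁, hb₂, hb]; norm_num
  have h1D : inner ℝ b₁ (b₁ - b₂) = (1 : ℝ) := by rw [inner_sub_right, hbb, hb]; norm_num
  have h2D : inner ℝ b₂ (b₁ - b₂) = (-1 : ℝ) := by rw [inner_sub_right, hbb', hb']; norm_num
  have hzD : |inner ℝ z (b₁ - b₂)| ≤ 2 * √d / √n := by
    rw [hz, real_inner_smul_left, sum_inner, abs_mul, abs_of_pos (by positivity)]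
    have h1 := h.sum_inner_le
    rw [Real.sqrt_mul hd'.le] at h1
    rw [inv_mul_le_iff₀ hn']
    refine h1.trans (le_of_eq ?_)
    field_simp
    rw [hsn2]
  have key := one_sub_inner_sq_le_of_gap (M := sampleCov (corrupted S₁ S₂ l b₁ b₂ x)) (v := v)
    (D := b₁ - b₂) (s := σ) (α := η * d) (γ := ε ^ 2 * d / 3) (β := 6 * (d / √n)) hv.1 hv.2 hD
    ?_ ?_ ?_ ?_
  · refine key.trans ?_
    have h1 : ε ^ 2 * d / 4 ≤ ε ^ 2 * d / 3 - η * d := by nlinarith [mul_pos (pow_pos hε 2) hd']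
    have h2 : 6 * (d / √n) / (ε ^ 2 * d / 3 - η * d) ≤ 24 / (ε ^ 2 * √n) := by
      calc 6 * (d / √n) / (ε ^ 2 * d / 3 - η * d) ≤ 6 * (d / √n) / (ε ^ 2 * d / 4) := by
            gcongr
        _ = _ := by field_simp; norm_num
    calc _ ≤ (24 / (ε ^ 2 * √n)) ^ 2 := by
          refine pow_le_pow_left₀ (div_nonneg (by positivity) ?_) h2 2
          exact le_trans (by positivity) h1
      _ = _ := by rw [div_pow, mul_pow, hsn2]; ring
  · nlinarith [mul_pos (pow_pos hε 2) hd']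
  -- The placed part of the mean is orthogonal to D, so centering costs only ⟨z, D⟩² ≤ 4d/n ≤ 2ηd.
  · rw [hp.inner_sampleCov_corrupted hn0, ← hz, ← hσ, h1D, h2D, inner_add_left, h1D, h2D]
    have h1 : 0 ≤ (n : ℝ)⁻¹ * ∑ i ∈ (S₁ ∪ S₂)ᶜ, inner ℝ (x i) (b₁ - b₂) * inner ℝ (x i) (b₁ - b₂) :=
      mul_nonneg (by positivity) (Finset.sum_nonneg fun i _ => mul_self_nonneg _)
    have h2 : inner ℝ z (b₁ - b₂) ^ 2 ≤ 2 * (η * d) := by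
      have h3 : (2 * √d / √n) ^ 2 ≤ 2 * (η * d) := by
        rw [div_pow, mul_pow, hsd2, hsn2, div_le_iff₀ hn']
        nlinarith
      refine le_trans ?_ h3
      rw [← sq_abs]
      exact pow_le_pow_left₀ (abs_nonneg _) hzD 2
    nlinarith
  · intro u hu
    rw [inner_sub_left, sub_eq_zero] at hu
    rw [hp.inner_sampleCov_corrupted hn0, ← hz, ← hσ, inner_add_left, ← hu]
    set t := inner ℝ b₁ u with ht
    have ht2 : 2 * t ^ 2 ≤ ‖u‖ ^ 2 := by
      have h1 := real_inner_mul_inner_self_le (b₁ + b₂) u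
      rw [real_inner_self_eq_norm_sq, real_inner_self_eq_norm_sq, hDp, inner_add_left, ← hu,
        ← ht] at h1
      linarith
    have hA : (n : ℝ)⁻¹ * ∑ i ∈ (S₁ ∪ S₂)ᶜ, inner ℝ (x i) u * inner ℝ (x i) u ≤
        2 * η * d * ‖u‖ ^ 2 := by
      rw [inv_mul_le_iff₀ hn']
      simp_rw [← sq]
      exact (h.sum_inner_sq_le_mul hη.le hn _ u).trans (le_of_eq (by ring))
    have hzu : |inner ℝ z u| ≤ ε * √d / 20 * ‖u‖ :=
      (abs_real_inner_le_norm z u).trans (mul_le_mul_of_nonneg_right hzn (norm_nonneg _))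
    exact centered_form_le hε.le hd'.le hη' hA hσge' ht2 (norm_nonneg u) hzu
  · intro u hu
    have hA := h.abs_sum_inner_mul_inner_le hu
    have hu' := hu
    rw [inner_sub_left, sub_eq_zero] at hu'
    rw [hp.inner_sampleCov_corrupted hn0, ← hz, ← hσ, h1D, h2D, inner_add_left (x := b₁)
      (z := b₁ - b₂), h1D, h2D, ← hu']
    -- Since b₁ and b₂ agree on u and are opposite on D, the placement cancels here.
    have e1 : ∀ a p q : ℝ, a + σ * (inner ℝ b₁ u * 1 + inner ℝ b₁ u * -1) -
        p * (q + ε * √d / 2 * (1 + -1)) = a - p * q := fun a p q => by ring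
    rw [e1]
    have hμ : |inner ℝ z u + ε * √d / 2 * inner ℝ (b₁ + b₂) u| ≤ √d * ‖u‖ := by
      have h1 : |inner ℝ z u| ≤ ε * √d / 20 * ‖u‖ :=
        (abs_real_inner_le_norm z u).trans (mul_le_mul_of_nonneg_right hzn (norm_nonneg _))
      have h2 : |inner ℝ (b₁ + b₂) u| ≤ 2 * ‖u‖ := by
        refine (abs_real_inner_le_norm _ u).trans (mul_le_mul_of_nonneg_right ?_ (norm_nonneg _))
        calc ‖b₁ + b₂‖ ≤ ‖b₁‖ + ‖b₂‖ := norm_add_le _ _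
          _ = 2 := by rw [hb₁, hb₂]; norm_num
      calc _ ≤ |inner ℝ z u| + |ε * √d / 2 * inner ℝ (b₁ + b₂) u| := abs_add_le _ _
        _ ≤ ε * √d / 20 * ‖u‖ + ε * √d / 2 * (2 * ‖u‖) := by
            rw [abs_mul, abs_of_pos (by positivity : 0 < ε * √d / 2)]
            gcongr
        _ = (ε * 21 / 20) * (√d * ‖u‖) := by ring
        _ ≤ 1 * (√d * ‖u‖) := by gcongr; linarith
        _ = _ := one_mul _
    exact abs_centered_form_le hd'.le hn' hA hμ hzD

theorem IsTypical.reduction_correct {τ : ℝ} (hε : 0 < ε) (hε1 : ε < 1 / 2) (hτ : 0 ≤ τ)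
    (hd : 0 < d) (hn : 2 ≤ resolution ε τ * n) {b₁ b₂ : EuclideanSpace ℝ (Fin d)} (hb₁ : ‖b₁‖ = 1)
    (hb₂ : ‖b₂‖ = 1) (hb : inner ℝ b₁ b₂ = 0) (hp : IsPlacement d ε S₁ S₂ l)
    {x : Fin n → EuclideanSpace ℝ (Fin d)} (h : IsTypical (resolution ε τ) (S₁ ∪ S₂)ᶜ b₁ b₂ x)
    {f : (Fin n → EuclideanSpace ℝ (Fin d)) → ℝ → EuclideanSpace ℝ (Fin d)}
    (hf : IsStrongRobustAggregator ε τ f)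
    (T : (Fin n → EuclideanSpace ℝ (Fin d)) → ℝ → ℕ) {δ : ℝ} (hδ : 2 < δ) :
    let Y' := corrupted S₁ S₂ l b₁ b₂ x
    let w := reductionOutput f T (S₁.card + S₂.card) Y' ‖sampleCov x‖
    (w = b₁ - b₂ ∨ w = b₂ - b₁) ∧ ∀ v, IsMaxVarianceDirection Y' v →
      InnerProductGeometry.angle w v ≤ Real.arccos √(1 - 144 / ε ^ 4 * (δ ^ 2 / n)) ∨
      InnerProductGeometry.angle w (-v) ≤ Real.arccos √(1 - 144 / ε ^ 4 * (δ ^ 2 / n)) := by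
  intro Y' w
  have hn' : (0 : ℝ) < n := by
    rcases (Nat.cast_nonneg (α := ℝ) n).eq_or_lt with h0 | h0
    · rw [← h0] at hn; norm_num at hn
    · exact h0
  have hpos : ∀ i ∈ S₁ ∪ S₂, 0 < √(d : ℝ) + l i := fun i hi => by
    have := abs_lt.1 (hp.abs_lt i hi)
    linarith [this.1]
  have hne : ∀ S : Finset (Fin n), (S.card : ℝ) = ε * n / 2 → S.Nonempty := fun S hS => by
    rw [← Finset.card_pos]
    have : (0 : ℝ) < S.card := by rw [hS]; positivity
    exact_mod_cast this
  have hw : w = b₁ - b₂ ∨ w = b₂ - b₁ := by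
    refine reductionOutput_eq hb₁ hb₂ hb hp.disjoint (hne _ hp.card_fst) (hne _ hp.card_snd)
      (fun i hi => ⟨_, hpos i (Finset.mem_union_left _ hi), ?_⟩)
      (fun i hi => ⟨_, hpos i (Finset.mem_union_right _ hi), ?_⟩)
      (h.score_lt hε hε1 hτ hd hn hb₁ hb₂ hb hp hf)
    · simp only [Y']; rw [corrupted, if_pos hi]
    · simp only [Y']; rw [corrupted, if_neg (Finset.disjoint_right.1 hp.disjoint hi), if_pos hi]
  refine ⟨hw, fun v hv => ?_⟩
  have hD : ‖b₁ - b₂‖ ^ 2 = 2 := by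
    rw [norm_sub_sq_real, hb₁, hb₂, hb]; norm_num
  refine angle_le_or_angle_neg_le hD (by rwa [neg_sub]) hv.1
    ((h.one_sub_inner_sq_le hε hε1 hτ hd hn hb₁ hb₂ hb hp hv).trans ?_)
  -- This fixes K = 144/ε⁴: the remaining 4 is at most δ².
  have : 576 / (ε ^ 4 * n) = 144 / ε ^ 4 * (4 / n) := by field_simp; norm_num
  rw [this]
  gcongr
  nlinarith

end Typical

/-! ### Concentration of Gaussian sums and sums of squares -/

section Concentration

open scoped NNReal

/-- Needed for the moment generating function of a centered squared Gaussian. For w ≥ 0 the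
quadratic lower bound of exp at w + w² is used; for w ≤ 0 the linear one suffices. -/
theorem exp_neg_sub_sq_le {w : ℝ} (h : |w| ≤ 1 / 2) : Real.exp (-w - w ^ 2) ≤ 1 - w := by
  obtain ⟨h1, h2⟩ := abs_le.1 h
  have h3 : -w - w ^ 2 = -(w + w ^ 2) := by ring
  rw [h3, Real.exp_neg]
  apply inv_le_of_inv_le₀ (by linarith)
  rw [inv_le_iff_one_le_mul₀' (by linarith)]
  rcases le_total 0 w with hw | hw
  · have h4 := Real.quadratic_le_exp_of_nonneg (x := w + w ^ 2) (by positivity)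
    refine le_trans ?_ (mul_le_mul_of_nonneg_left h4 (by linarith))
    have h5 : (1 - w) * (1 + (w + w ^ 2) + (w + w ^ 2) ^ 2 / 2) =
        1 + w ^ 2 * (1 - w - w ^ 2 - w ^ 3) / 2 := by ring
    rw [h5]
    have h6 : w ^ 2 ≤ 1 / 4 := by nlinarith
    have h7 : w ^ 3 ≤ 1 / 8 := by nlinarith
    have : 0 ≤ w ^ 2 * (1 - w - w ^ 2 - w ^ 3) := mul_nonneg (sq_nonneg _) (by linarith)
    linarith
  · have h4 := Real.add_one_le_exp (w + w ^ 2)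
    refine le_trans ?_ (mul_le_mul_of_nonneg_left h4 (by linarith))
    have h5 : 0 ≤ -w * w ^ 2 := mul_nonneg (by linarith) (sq_nonneg _)
    linarith

theorem integral_exp_mul_sq_gaussianReal {v : ℝ≥0} (hv : v ≠ 0) {s : ℝ} (hs : 2 * s * v < 1) :
    ∫ y, Real.exp (s * y ^ 2) ∂(gaussianReal 0 v) = (√(1 - 2 * s * v))⁻¹ := by
  have hv' : (0 : ℝ) < v := by positivity
  rw [integral_gaussianReal_eq_integral_smul hv]
  have h1 : ∀ y : ℝ, gaussianPDFReal 0 v y • Real.exp (s * y ^ 2) =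
      (√(2 * Real.pi * v))⁻¹ * Real.exp (-((1 - 2 * s * v) / (2 * v)) * y ^ 2) := by
    intro y
    rw [gaussianPDFReal_def, smul_eq_mul, mul_assoc, ← Real.exp_add]
    congr 2
    field_simp
    ring
  simp_rw [h1]
  rw [integral_const_mul, integral_gaussian, ← Real.sqrt_inv, ← Real.sqrt_mul (by positivity),
    ← Real.sqrt_inv]
  congr 1
  have : 1 - 2 * s * v ≠ 0 := by linarith
  field_simp

theorem mgf_sq_sub_le {Ω : Type*} [MeasurableSpace Ω] {P : Measure Ω} {Z : Ω → ℝ} (hZ : Measurable Z) {v : ℝ≥0} (hv : v ≠ 0)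
    (hlaw : P.map Z = gaussianReal 0 v) {s : ℝ} (hs : |s * v| ≤ 1 / 4) :
    Integrable (fun ω => Real.exp (s * (Z ω ^ 2 - v))) P ∧
      mgf (fun ω => Z ω ^ 2 - v) P s ≤ Real.exp (2 * s ^ 2 * v ^ 2) := by
  obtain ⟨hs1, hs2⟩ := abs_le.1 hs
  have h1 : mgf (fun ω => Z ω ^ 2 - v) P s =
      Real.exp (-(s * v)) * (√(1 - 2 * s * v))⁻¹ := by
    rw [← integral_exp_mul_sq_gaussianReal hv (by linarith), ← hlaw,
      integral_map hZ.aemeasurable (by fun_prop), ← integral_const_mul, mgf]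
    refine integral_congr_ae (ae_of_all _ fun ω => ?_)
    simp only
    rw [← Real.exp_add]
    congr 1
    ring
  have hpos : 0 < √(1 - 2 * s * v) := Real.sqrt_pos.2 (by linarith)
  -- A nonintegrable function would have integral 0, so the positive closed form yields
  -- integrability.
  refine ⟨Integrable.of_integral_ne_zero ?_, ?_⟩
  · change mgf (fun ω => Z ω ^ 2 - v) P s ≠ 0
    rw [h1]
    positivity
  · rw [h1, ← div_eq_mul_inv, div_le_iff₀ hpos]
    have h2 := exp_neg_sub_sq_le (w := 2 * (s * v)) (by
      rw [abs_mul, abs_of_pos (by norm_num : (0 : ℝ) < 2)]; linarith)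
    have h3 : Real.exp (-(s * v) - 2 * s ^ 2 * v ^ 2) ≤ √(1 - 2 * s * v) := by
      apply Real.le_sqrt_of_sq_le
      rw [← Real.exp_nat_mul]
      refine le_trans (le_of_eq ?_) (h2.trans (le_of_eq ?_))
      · congr 1; push_cast; ring
      · ring
    calc Real.exp (-(s * v)) =
          Real.exp (2 * s ^ 2 * v ^ 2) * Real.exp (-(s * v) - 2 * s ^ 2 * v ^ 2) := by
          rw [← Real.exp_add]; congr 1; ring
      _ ≤ _ := by gcongr

variable {Ω ι : Type*} [MeasurableSpace Ω] {P : Measure Ω} [IsProbabilityMeasure P]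

theorem mgf_sum_sq_sub_le {Z : ι → Ω → ℝ} (hZ : ∀ i, Measurable (Z i)) (hind : iIndepFun Z P)
    {v : ℝ≥0} (hv : v ≠ 0) (hlaw : ∀ i, P.map (Z i) = gaussianReal 0 v) (S : Finset ι) {s : ℝ}
    (hs : |s * v| ≤ 1 / 4) :
    Integrable (fun ω => Real.exp (s * ∑ i ∈ S, (Z i ω ^ 2 - v))) P ∧
      mgf (fun ω => ∑ i ∈ S, (Z i ω ^ 2 - v)) P s ≤ Real.exp (2 * s ^ 2 * v ^ 2 * S.card) := by
  set W : ι → Ω → ℝ := fun i ω => Z i ω ^ 2 - v with hW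
  have hWm : ∀ i, Measurable (W i) := fun i => by
    have := hZ i
    simp only [hW]
    fun_prop
  have hWind : iIndepFun W P := hind.comp (fun _ y => y ^ 2 - (v : ℝ)) (fun _ => by fun_prop)
  have hsum : (fun ω => ∑ i ∈ S, (Z i ω ^ 2 - v)) = ∑ i ∈ S, W i := by
    ext ω; simp [hW]
  have hb := fun i => mgf_sq_sub_le (hZ i) hv (hlaw i) hs
  constructor
  · have := hWind.integrable_exp_mul_sum hWm (s := S) (t := s) (fun i _ => (hb i).1)
    rw [← hsum] at this
    exact this
  · rw [hsum, hWind.mgf_sum hWm]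
    calc ∏ i ∈ S, mgf (W i) P s ≤ ∏ _i ∈ S, Real.exp (2 * s ^ 2 * v ^ 2) :=
          Finset.prod_le_prod (fun i _ => mgf_nonneg) (fun i _ => (hb i).2)
      _ = _ := by rw [Finset.prod_const, ← Real.exp_nat_mul]; congr 1; ring

/-- Chernoff's bound, with `s` left free because the applications use different scales. -/
theorem measureReal_le_sum_sq_sub {Z : ι → Ω → ℝ} (hZ : ∀ i, Measurable (Z i))
    (hind : iIndepFun Z P) {v : ℝ≥0} (hv : v ≠ 0) (hlaw : ∀ i, P.map (Z i) = gaussianReal 0 v)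
    (S : Finset ι) {s : ℝ} (hs0 : 0 ≤ s) (hs : s * v ≤ 1 / 4) (t : ℝ) :
    P.real {ω | t ≤ ∑ i ∈ S, (Z i ω ^ 2 - v)} ≤
      Real.exp (-s * t + 2 * s ^ 2 * v ^ 2 * S.card) := by
  obtain ⟨h1, h2⟩ := mgf_sum_sq_sub_le hZ hind hv hlaw S (s := s)
    (by rwa [abs_of_nonneg (by positivity)])
  refine (measure_ge_le_exp_mul_mgf t hs0 h1).trans ?_
  rw [Real.exp_add]
  gcongr

theorem measureReal_sum_sq_sub_le {Z : ι → Ω → ℝ} (hZ : ∀ i, Measurable (Z i))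
    (hind : iIndepFun Z P) {v : ℝ≥0} (hv : v ≠ 0) (hlaw : ∀ i, P.map (Z i) = gaussianReal 0 v)
    (S : Finset ι) {s : ℝ} (hs0 : 0 ≤ s) (hs : s * v ≤ 1 / 4) (t : ℝ) :
    P.real {ω | ∑ i ∈ S, (Z i ω ^ 2 - v) ≤ -t} ≤
      Real.exp (-s * t + 2 * s ^ 2 * v ^ 2 * S.card) := by
  obtain ⟨h1, h2⟩ := mgf_sum_sq_sub_le hZ hind hv hlaw S (s := -s)
    (by rwa [neg_mul, abs_neg, abs_of_nonneg (by positivity)])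
  refine (measure_le_le_exp_mul_mgf (-t) (by linarith) h1).trans ?_
  rw [Real.exp_add]
  rw [neg_sq] at h2
  have : - -s * -t = -s * t := by ring
  rw [this]
  gcongr

theorem measureReal_le_abs_sum_sq_sub {Z : ι → Ω → ℝ} (hZ : ∀ i, Measurable (Z i))
    (hind : iIndepFun Z P) {v : ℝ≥0} (hv : v ≠ 0) (hlaw : ∀ i, P.map (Z i) = gaussianReal 0 v)
    (S : Finset ι) {s : ℝ} (hs0 : 0 ≤ s) (hs : s * v ≤ 1 / 4) (t : ℝ) :
    P.real {ω | t ≤ |∑ i ∈ S, (Z i ω ^ 2 - v)|} ≤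
      2 * Real.exp (-s * t + 2 * s ^ 2 * v ^ 2 * S.card) := by
  have h1 : {ω | t ≤ |∑ i ∈ S, (Z i ω ^ 2 - v)|} ⊆
      {ω | t ≤ ∑ i ∈ S, (Z i ω ^ 2 - v)} ∪ {ω | ∑ i ∈ S, (Z i ω ^ 2 - v) ≤ -t} := by
    intro ω hω
    rcases le_abs.1 (Set.mem_ofPred.1 hω) with h | h
    · exact Or.inl h
    · exact Or.inr (by simp only [Set.mem_ofPred]; linarith)
  have h2 := measureReal_le_sum_sq_sub hZ hind hv hlaw S hs0 hs t
  have h3 := measureReal_sum_sq_sub_le hZ hind hv hlaw S hs0 hs t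
  linarith [(measureReal_mono (μ := P) h1).trans (measureReal_union_le _ _)]

theorem measureReal_le_abs_sum {Z : ι → Ω → ℝ} (hZ : ∀ i, Measurable (Z i))
    (hind : iIndepFun Z P) {v : ℝ≥0} (hlaw : ∀ i, P.map (Z i) = gaussianReal 0 v)
    (S : Finset ι) {s : ℝ} (hs0 : 0 ≤ s) (t : ℝ) :
    P.real {ω | t ≤ |∑ i ∈ S, Z i ω|} ≤ 2 * Real.exp (-s * t + v * s ^ 2 / 2 * S.card) := by
  have hsum : (fun ω => ∑ i ∈ S, Z i ω) = ∑ i ∈ S, Z i := by ext ω; simp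
  have hint : ∀ r, Integrable (fun ω => Real.exp (r * ∑ i ∈ S, Z i ω)) P := by
    intro r
    have := hind.integrable_exp_mul_sum hZ (s := S) (t := r) (fun i _ => by
      have h := integrable_exp_mul_gaussianReal (μ := 0) (v := v) r
      rw [← hlaw i] at h
      exact h.comp_measurable (hZ i))
    rw [← hsum] at this
    exact this
  have hmgf : ∀ r, mgf (fun ω => ∑ i ∈ S, Z i ω) P r = Real.exp (v * r ^ 2 / 2 * S.card) := by
    intro r
    rw [hsum, hind.mgf_sum hZ]
    simp_rw [mgf_gaussianReal (hlaw _)]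
    rw [Finset.prod_const, ← Real.exp_nat_mul]
    congr 1
    ring
  have h1 : {ω | t ≤ |∑ i ∈ S, Z i ω|} ⊆
      {ω | t ≤ ∑ i ∈ S, Z i ω} ∪ {ω | ∑ i ∈ S, Z i ω ≤ -t} := by
    intro ω hω
    rcases le_abs.1 (Set.mem_ofPred.1 hω) with h | h
    · exact Or.inl h
    · exact Or.inr (by simp only [Set.mem_ofPred]; linarith)
  have h2 := measure_ge_le_exp_mul_mgf (μ := P) t hs0 (hint s)
  have h3 := measure_le_le_exp_mul_mgf (μ := P) (-t) (by linarith : -s ≤ 0) (hint (-s))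
  rw [hmgf, ← Real.exp_add] at h2 h3
  rw [neg_sq, show - -s * -t = -s * t by ring] at h3
  linarith [(measureReal_mono (μ := P) h1).trans (measureReal_union_le _ _)]

end Concentration

/-! ### Standard Gaussian samples are typical -/

section GaussianSample

open scoped NNReal

variable {n d : ℕ}

local notation "E" => EuclideanSpace ℝ (Fin d)

theorem stdGaussian_map_inner (u : E) :
    (stdGaussian E).map (fun x => inner ℝ x u) = gaussianReal 0 (‖u‖₊ ^ 2) := by
  have h := IsGaussian.map_eq_gaussianReal (μ := stdGaussian E) (innerSL ℝ u)
  rw [variance_dual_stdGaussian, integral_strongDual_stdGaussian, innerSL_apply_norm] at h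
  have h1 : (fun x : E => inner ℝ x u) = ⇑(innerSL ℝ u) := by
    ext x; rw [innerSL_apply_apply, real_inner_comm]
  rw [h1, h]
  congr 1
  ext
  simp

theorem stdGaussian_norm_sq_tail :
    (stdGaussian E).real {x | ¬ ((d : ℝ) / 2 ≤ ‖x‖ ^ 2 ∧ ‖x‖ ^ 2 ≤ 2 * d)} ≤
      2 * Real.exp (-d / 32) := by
  set μ := Measure.pi (fun _ : Fin d => gaussianReal 0 1) with hμ
  have hZ : ∀ i : Fin d, Measurable (fun y : Fin d → ℝ => y i) := fun i => measurable_pi_apply i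
  have hind : iIndepFun (fun (i : Fin d) (y : Fin d → ℝ) => y i) μ :=
    iIndepFun_pi (X := fun _ y => y) (fun _ => aemeasurable_id)
  have hlaw : ∀ i : Fin d, μ.map (fun y : Fin d → ℝ => y i) = gaussianReal 0 1 := fun i =>
    (measurePreserving_eval _ i).map_eq
  -- The exponents are -d/4 + d/8 for the upper tail and -d/16 + d/32 for the lower one, which is
  -- the binding one.
  have h1 := measureReal_le_sum_sq_sub hZ hind one_ne_zero hlaw Finset.univ (s := 1 / 4)
    (by norm_num) (by norm_num) d
  have h2 := measureReal_sum_sq_sub_le hZ hind one_ne_zero hlaw Finset.univ (s := 1 / 8)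
    (by norm_num) (by norm_num) (d / 2)
  have hmeas : MeasurableSet {x : E | ¬ ((d : ℝ) / 2 ≤ ‖x‖ ^ 2 ∧ ‖x‖ ^ 2 ≤ 2 * d)} := by
    measurability
  rw [← map_pi_eq_stdGaussian, map_measureReal_apply (by fun_prop) hmeas]
  have hsub : WithLp.toLp 2 ⁻¹' {x : E | ¬ ((d : ℝ) / 2 ≤ ‖x‖ ^ 2 ∧ ‖x‖ ^ 2 ≤ 2 * d)} ⊆
      {y : Fin d → ℝ | (d : ℝ) ≤ ∑ i, (y i ^ 2 - ((1 : ℝ≥0) : ℝ))} ∪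
      {y | ∑ i, (y i ^ 2 - ((1 : ℝ≥0) : ℝ)) ≤ -((d : ℝ) / 2)} := by
    intro y hy
    rw [Set.mem_preimage, Set.mem_ofPred, EuclideanSpace.real_norm_sq_eq, not_and_or, not_le,
      not_le] at hy
    simp only [NNReal.coe_one, Set.mem_union, Set.mem_ofPred_eq, Finset.sum_sub_distrib,
      Finset.sum_const, Finset.card_univ, Fintype.card_fin, nsmul_eq_mul, mul_one]
    rcases hy with h | h
    · right; linarith
    · left; linarith
  refine (measureReal_mono hsub).trans ((measureReal_union_le _ _).trans ?_)
  refine (add_le_add h1 h2).trans ?_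
  have hd : (0 : ℝ) ≤ d := by positivity
  have e1 : Real.exp (-(1 / 4) * d + 2 * (1 / 4) ^ 2 * ((1 : ℝ≥0) : ℝ) ^ 2 *
      (Finset.univ : Finset (Fin d)).card) ≤ Real.exp (-d / 32) := by
    apply Real.exp_le_exp.2
    simp
    linarith
  have e2 : Real.exp (-(1 / 8) * (d / 2) + 2 * (1 / 8) ^ 2 * ((1 : ℝ≥0) : ℝ) ^ 2 *
      (Finset.univ : Finset (Fin d)).card) ≤ Real.exp (-d / 32) := by
    apply Real.exp_le_exp.2
    simp
    linarith
  linarith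

theorem stdGaussian_inner_tail (u : E) {s : ℝ} (hs : 0 ≤ s) (t : ℝ) :
    (stdGaussian E).real {x | t ≤ |inner ℝ x u|} ≤
      2 * Real.exp (-s * t + ‖u‖ ^ 2 * s ^ 2 / 2) := by
  have h := measureReal_le_abs_sum (P := stdGaussian E) (ι := Unit)
    (Z := fun _ x => inner ℝ x u) (fun _ => by fun_prop) iIndepFun.of_subsingleton
    (fun _ => stdGaussian_map_inner u) Finset.univ hs t
  simpa using h

/-- Conditioning by Fubini, used once for one Gaussian vector given another and once for the sample
given the directions. -/
theorem measure_prod_le_of_ae_le {α β : Type*} [MeasurableSpace α] [MeasurableSpace β]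
    {μ : Measure α} {ν : Measure β} [IsProbabilityMeasure μ] [IsProbabilityMeasure ν]
    {s : Set (α × β)} (hs : MeasurableSet s) {c : ENNReal}
    (h : ∀ᵐ x ∂μ, ν (Prod.mk x ⁻¹' s) ≤ c) : (μ.prod ν) s ≤ c := by
  rw [Measure.prod_apply hs]
  calc _ ≤ ∫⁻ _, c ∂μ := lintegral_mono_ae h
    _ = c := by simp

variable (n d) in
/-- The law of a sample of `n` independent standard Gaussian vectors. -/
noncomputable def gaussianSample : Measure (Fin n → E) :=
  Measure.pi (fun _ => stdGaussian E)

instance : IsProbabilityMeasure (gaussianSample n d) := by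
  unfold gaussianSample; infer_instance

theorem gaussianSample_map_eval (i : Fin n) :
    (gaussianSample n d).map (fun x => x i) = stdGaussian E :=
  (measurePreserving_eval _ i).map_eq

theorem gaussianSample_map_inner (u : E) (i : Fin n) :
    (gaussianSample n d).map (fun x => inner ℝ (x i) u) = gaussianReal 0 (‖u‖₊ ^ 2) := by
  rw [← stdGaussian_map_inner, ← gaussianSample_map_eval i, Measure.map_map (by fun_prop)
    (by fun_prop)]
  rfl

theorem iIndepFun_gaussianSample_inner (u : E) :
    iIndepFun (fun (i : Fin n) (x : Fin n → E) => inner ℝ (x i) u) (gaussianSample n d) :=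
  iIndepFun_pi (X := fun _ (y : E) => inner ℝ y u) (fun _ => by fun_prop)

theorem gaussianSample_norm_sq_tail (i : Fin n) :
    (gaussianSample n d).real {x | ¬ ((d : ℝ) / 2 ≤ ‖x i‖ ^ 2 ∧ ‖x i‖ ^ 2 ≤ 2 * d)} ≤
      2 * Real.exp (-d / 32) := by
  have h := stdGaussian_norm_sq_tail (d := d)
  rw [← gaussianSample_map_eval i, map_measureReal_apply (by fun_prop) (by measurability)] at h
  exact h

/-- Given xᵢ = u, the inner product is N(0, ‖u‖²). Including ‖u‖² ≤ 2d in the event makes the bound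
uniform in u; s = η/2 gives -η²d/2 + η²d/4. -/
theorem gaussianSample_inner_tail {η : ℝ} (hη : 0 ≤ η) {i j : Fin n} (hij : i ≠ j) :
    (gaussianSample n d).real {x | ‖x i‖ ^ 2 ≤ 2 * d ∧ η * d ≤ |inner ℝ (x i) (x j)|} ≤
      2 * Real.exp (-(η ^ 2 / 4) * d) := by
  have hmap : (gaussianSample n d).map (fun x => (x i, x j)) =
      (stdGaussian E).prod (stdGaussian E) := by
    have h := (iIndepFun_pi (μ := fun _ : Fin n => stdGaussian E) (X := fun _ (y : E) => y)
      (fun _ => by fun_prop)).indepFun hij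
    rw [indepFun_iff_map_prod_eq_prod_map_map (measurable_pi_apply i).aemeasurable
      (measurable_pi_apply j).aemeasurable] at h
    have h1 := gaussianSample_map_eval (d := d) i
    have h2 := gaussianSample_map_eval (d := d) j
    rw [gaussianSample] at h1 h2 ⊢
    rw [h, h1, h2]
  have hmeas : MeasurableSet {p : E × E | ‖p.1‖ ^ 2 ≤ 2 * d ∧ η * d ≤ |inner ℝ p.1 p.2|} := by
    measurability
  have hprod : ((stdGaussian E).prod (stdGaussian E))
      {p : E × E | ‖p.1‖ ^ 2 ≤ 2 * d ∧ η * d ≤ |inner ℝ p.1 p.2|} ≤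
      ENNReal.ofReal (2 * Real.exp (-(η ^ 2 / 4) * d)) := by
    refine measure_prod_le_of_ae_le hmeas (ae_of_all _ fun u => ?_)
    by_cases hu : ‖u‖ ^ 2 ≤ 2 * d
    · have h1 := stdGaussian_inner_tail u (s := η / 2) (by positivity) (η * d)
      have h2 : Prod.mk u ⁻¹' {p : E × E | ‖p.1‖ ^ 2 ≤ 2 * d ∧ η * d ≤ |inner ℝ p.1 p.2|} ⊆
          {x | η * d ≤ |inner ℝ x u|} := by
        intro x hx
        rw [Set.mem_ofPred, real_inner_comm]
        exact hx.2
      refine (measure_mono h2).trans ?_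
      rw [← ENNReal.ofReal_toReal (measure_ne_top (stdGaussian E) _)]
      refine ENNReal.ofReal_le_ofReal (h1.trans ?_)
      gcongr
      have : ‖u‖ ^ 2 * (η / 2) ^ 2 / 2 ≤ 2 * d * (η / 2) ^ 2 / 2 := by gcongr
      linarith
    · have : Prod.mk u ⁻¹' {p : E × E | ‖p.1‖ ^ 2 ≤ 2 * d ∧ η * d ≤ |inner ℝ p.1 p.2|} = ∅ := by
        ext x
        simp [hu]
      rw [this]
      simp
  rw [← hmap, Measure.map_apply (by fun_prop) hmeas] at hprod
  exact ENNReal.toReal_le_of_le_ofReal (by positivity) hprod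

theorem gaussianSample_abs_sum_inner_tail (u : E) (S : Finset (Fin n)) {s : ℝ} (hs : 0 ≤ s)
    (t : ℝ) : (gaussianSample n d).real {x | t ≤ |∑ i ∈ S, inner ℝ (x i) u|} ≤
      2 * Real.exp (-s * t + ‖u‖ ^ 2 * s ^ 2 / 2 * S.card) := by
  have h := measureReal_le_abs_sum (P := gaussianSample n d)
    (Z := fun i x => inner ℝ (x i) u) (fun _ => by fun_prop) (iIndepFun_gaussianSample_inner u)
    (fun i => gaussianSample_map_inner u i) S hs t
  simpa using h

theorem gaussianSample_abs_sum_inner_sq_tail {u : E} (hu : u ≠ 0) (S : Finset (Fin n)) {s : ℝ}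
    (hs : 0 ≤ s) (hs' : s * ‖u‖ ^ 2 ≤ 1 / 4) (t : ℝ) :
    (gaussianSample n d).real {x | t ≤ |∑ i ∈ S, (inner ℝ (x i) u ^ 2 - ‖u‖ ^ 2)|} ≤
      2 * Real.exp (-s * t + 2 * s ^ 2 * (‖u‖ ^ 2) ^ 2 * S.card) := by
  have h := measureReal_le_abs_sum_sq_sub (P := gaussianSample n d)
    (Z := fun i x => inner ℝ (x i) u) (fun _ => by fun_prop) (iIndepFun_gaussianSample_inner u)
    (by simpa using hu) (fun i => gaussianSample_map_inner u i) S hs (by simpa using hs') t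
  simpa using h

theorem measurableSet_isTypical (η : ℝ) (G : Finset (Fin n)) :
    MeasurableSet {p : (E × E) × (Fin n → E) | IsTypical η G p.1.1 p.1.2 p.2} := by
  have h : {p : (E × E) × (Fin n → E) | IsTypical η G p.1.1 p.1.2 p.2} =
      (⋂ i, {p | (d : ℝ) / 2 ≤ ‖p.2 i‖ ^ 2}) ∩ (⋂ i, {p | ‖p.2 i‖ ^ 2 ≤ 2 * d}) ∩
      (⋂ i, ⋂ j, ⋂ (_ : i ≠ j), {p | |inner ℝ (p.2 i) (p.2 j)| ≤ η * d}) ∩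
      (⋂ i, {p | |inner ℝ (p.2 i) (p.1.1 + p.1.2)| ≤ √d / 4}) ∩
      {p | |∑ i ∈ G, inner ℝ (p.2 i) (p.1.1 - p.1.2)| ≤ 2 * √(d * n)} ∩
      (⋂ (_ : d ≤ n), ⋂ k, {p | |∑ i ∈ G, inner ℝ (p.2 i) (p.1.1 - p.1.2) * p.2 i k -
        G.card * (p.1.1 - p.1.2) k| ≤ 4 * √(d * n)}) ∩
      (⋂ (_ : n ≤ d), {p | ∑ i ∈ G, inner ℝ (p.2 i) (p.1.1 - p.1.2) ^ 2 ≤ 4 * d}) := by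
    ext p
    simp only [Set.mem_inter_iff, Set.mem_iInter, Set.mem_ofPred_eq]
    exact ⟨fun h => ⟨⟨⟨⟨⟨⟨h.1, h.2⟩, h.3⟩, h.4⟩, h.5⟩, h.6⟩, h.7⟩,
      fun ⟨⟨⟨⟨⟨⟨h1, h2⟩, h3⟩, h4⟩, h5⟩, h6⟩, h7⟩ => ⟨h1, h2, h3, h4, h5, h6, h7⟩⟩
  rw [h]
  have hc : ∀ i k, Continuous fun p : (E × E) × (Fin n → E) => p.2 i k := fun i k =>
    (EuclideanSpace.proj (𝕜 := ℝ) k).continuous.comp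
      ((continuous_apply i).comp continuous_snd)
  have hc' : ∀ k, Continuous fun p : (E × E) × (Fin n → E) => (p.1.1 - p.1.2) k := fun k =>
    (EuclideanSpace.proj (𝕜 := ℝ) k).continuous.comp
      ((continuous_fst.comp continuous_fst).sub (continuous_snd.comp continuous_fst))
  refine (((((((isClosed_iInter fun i => ?_).inter (isClosed_iInter fun i => ?_)).inter
    (isClosed_iInter fun i => isClosed_iInter fun j => isClosed_iInter fun _ => ?_)).inter
    (isClosed_iInter fun i => ?_)).inter ?_).inter
    (isClosed_iInter fun _ => isClosed_iInter fun k => ?_)).inter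
    (isClosed_iInter fun _ => ?_)).measurableSet
  · exact isClosed_le (by fun_prop) (by fun_prop)
  · exact isClosed_le (by fun_prop) (by fun_prop)
  · exact isClosed_le (by fun_prop) (by fun_prop)
  · exact isClosed_le (by fun_prop) (by fun_prop)
  · exact isClosed_le (by fun_prop) (by fun_prop)
  · refine isClosed_le (Continuous.abs (Continuous.sub ?_ ?_)) (by fun_prop)
    · exact continuous_finsetSum _ fun i _ => Continuous.mul (by fun_prop) (hc i k)
    · exact continuous_const.mul (hc' k)
  · exact isClosed_le (by fun_prop) (by fun_prop)

/-- Polarization with the basis vector eₖ, which reduces the products to centered sums of squares.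
-/
theorem sum_inner_mul_apply_sub_eq (G : Finset (Fin n)) (x : Fin n → E) (D : E) (k : Fin d) :
    ∑ i ∈ G, inner ℝ (x i) D * x i k - G.card * D k =
      (∑ i ∈ G, (inner ℝ (x i) (D + EuclideanSpace.single k 1) ^ 2 -
          ‖D + EuclideanSpace.single k 1‖ ^ 2) -
        ∑ i ∈ G, (inner ℝ (x i) (D - EuclideanSpace.single k 1) ^ 2 -
          ‖D - EuclideanSpace.single k 1‖ ^ 2)) / 4 := by
  set e : E := EuclideanSpace.single k 1 with he
  have hxe : ∀ y : E, inner ℝ y e = y k := fun y => by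
    rw [he, EuclideanSpace.inner_single_right]; simp
  rw [← Finset.sum_sub_distrib, Finset.sum_div, ← nsmul_eq_mul, ← Finset.sum_const,
    ← Finset.sum_sub_distrib]
  refine Finset.sum_congr rfl fun i _ => ?_
  rw [inner_add_right, inner_sub_right, norm_add_sq_real, norm_sub_sq_real, hxe, hxe]
  ring

/-- After polarization two deviations of 8√(dn) are divided by 4, giving 4√(dn). For n ≤ d the mean
2|G| ≤ 2d and a deviation 2d add to 4d. -/
theorem not_isTypical_subset (η : ℝ) (G : Finset (Fin n)) {b₁ b₂ : E}
    (hD : ‖b₁ - b₂‖ ^ 2 = 2) :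
    {x | ¬ IsTypical η G b₁ b₂ x} ⊆
      (⋃ i, {x | ¬ ((d : ℝ) / 2 ≤ ‖x i‖ ^ 2 ∧ ‖x i‖ ^ 2 ≤ 2 * d)}) ∪
      (⋃ p : Fin n × Fin n, {x | p.1 ≠ p.2 ∧ ‖x p.1‖ ^ 2 ≤ 2 * d ∧
        η * d ≤ |inner ℝ (x p.1) (x p.2)|}) ∪
      (⋃ i, {x | √d / 4 ≤ |∑ i ∈ {i}, inner ℝ (x i) (b₁ + b₂)|}) ∪
      {x | 2 * √(d * n) ≤ |∑ i ∈ G, inner ℝ (x i) (b₁ - b₂)|} ∪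
      (⋃ k, {x | d ≤ n ∧ 8 * √(d * n) ≤ |∑ i ∈ G,
        (inner ℝ (x i) (b₁ - b₂ + EuclideanSpace.single k 1) ^ 2 -
          ‖b₁ - b₂ + EuclideanSpace.single k 1‖ ^ 2)|}) ∪
      (⋃ k, {x | d ≤ n ∧ 8 * √(d * n) ≤ |∑ i ∈ G,
        (inner ℝ (x i) (b₁ - b₂ - EuclideanSpace.single k 1) ^ 2 -
          ‖b₁ - b₂ - EuclideanSpace.single k 1‖ ^ 2)|}) ∪
      {x | n ≤ d ∧ 2 * d ≤ |∑ i ∈ G, (inner ℝ (x i) (b₁ - b₂) ^ 2 - ‖b₁ - b₂‖ ^ 2)|} := by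
  intro x hx
  by_contra hc
  simp only [Set.mem_union, Set.mem_iUnion, Set.mem_ofPred_eq, not_or, not_exists, not_and,
    not_le] at hc
  obtain ⟨⟨⟨⟨⟨⟨h1, h2⟩, h3⟩, h4⟩, h5⟩, h6⟩, h7⟩ := hc
  have h1' : ∀ i, (d : ℝ) / 2 ≤ ‖x i‖ ^ 2 ∧ ‖x i‖ ^ 2 ≤ 2 * d := fun i => by
    have := h1 i
    rwa [Classical.not_imp, not_lt] at this
  refine hx ⟨fun i => (h1' i).1, fun i => (h1' i).2,
    fun i j hij => (h2 (i, j) hij (h1' i).2).le, fun i => ?_, h4.le, fun hdn k => ?_,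
    fun hnd => ?_⟩
  · have := (h3 i).le
    rwa [Finset.sum_singleton] at this
  · have h8 := h5 k hdn
    have h9 := h6 k hdn
    rw [sum_inner_mul_apply_sub_eq]
    rw [abs_lt] at h8 h9
    rw [abs_le]
    constructor <;> linarith [h8.1, h8.2, h9.1, h9.2]
  · have h8 := (abs_lt.1 (h7 hnd)).2
    rw [Finset.sum_sub_distrib, Finset.sum_const, nsmul_eq_mul, hD] at h8
    have hS : (G.card : ℝ) ≤ n := by exact_mod_cast (G.card_le_univ).trans_eq (by simp)
    have hnd' : (n : ℝ) ≤ d := by exact_mod_cast hnd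
    linarith

theorem gaussianSample_not_isTypical_le (hn : 0 < n) {η : ℝ} (hη : 0 ≤ η) (hη1 : η ≤ 1 / 4)
    (G : Finset (Fin n)) {b₁ b₂ : E} (hb₁ : ‖b₁‖ = 1) (hb₂ : ‖b₂‖ = 1)
    (hb : inner ℝ b₁ b₂ = 0) :
    (gaussianSample n d).real {x | ¬ IsTypical η G b₁ b₂ x} ≤
      14 * (n : ℝ) ^ 2 * Real.exp (-(η ^ 2 / 4) * d) := by
  have hD : ‖b₁ - b₂‖ ^ 2 = 2 := by
    rw [norm_sub_sq_real, hb₁, hb₂, hb]; norm_num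
  have hDp : ‖b₁ + b₂‖ ^ 2 = 2 := by
    rw [norm_add_sq_real, hb₁, hb₂, hb]; norm_num
  have hn1 : (1 : ℝ) ≤ n := by exact_mod_cast hn
  have hd0 : (0 : ℝ) ≤ d := by positivity
  have hG : (G.card : ℝ) ≤ n := by exact_mod_cast (G.card_le_univ).trans_eq (by simp)
  have hsn : 0 < √(n : ℝ) := Real.sqrt_pos.2 (by linarith)
  have hsd2 : √(d : ℝ) ^ 2 = d := Real.sq_sqrt hd0
  have hsn2 : √(n : ℝ) ^ 2 = n := Real.sq_sqrt (by linarith)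
  have hdn : √((d : ℝ) * n) = √d * √n := Real.sqrt_mul hd0 _
  set e := Real.exp (-(η ^ 2 / 4) * d) with he
  have he0 : 0 < e := Real.exp_pos _
  -- All tails except that of the pairwise inner products decay at least like exp(-d/64); η ≤ 1/4
  -- makes `e` the slowest.
  have hexp : ∀ r : ℝ, r ≤ -(1 / 64) * d → Real.exp r ≤ e := fun r hr => by
    refine Real.exp_le_exp.2 (hr.trans ?_)
    have : η ^ 2 / 4 ≤ 1 / 64 := by nlinarith
    nlinarith
  have hsq : √(d : ℝ) / √n * (√d * √n) = d := by
    field_simp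
    exact hsd2
  have hsq2 : (√(d : ℝ) / √n) ^ 2 * n = d := by
    rw [div_pow, hsd2, hsn2]; field_simp
  have b1 : ∀ i : Fin n, (gaussianSample n d).real
      {x | ¬ ((d : ℝ) / 2 ≤ ‖x i‖ ^ 2 ∧ ‖x i‖ ^ 2 ≤ 2 * d)} ≤ 2 * e := fun i =>
    (gaussianSample_norm_sq_tail i).trans (by
      have := hexp (-(d : ℝ) / 32) (by linarith)
      linarith)
  have b2 : ∀ p : Fin n × Fin n, (gaussianSample n d).real {x | p.1 ≠ p.2 ∧
      ‖x p.1‖ ^ 2 ≤ 2 * d ∧ η * d ≤ |inner ℝ (x p.1) (x p.2)|} ≤ 2 * e := fun p => by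
    by_cases hp : p.1 = p.2
    · simp only [hp, ne_eq, not_true_eq_false, false_and]
      have : (gaussianSample n d).real (∅ : Set (Fin n → E)) ≤ 2 * e := by
        rw [measureReal_empty]; positivity
      exact this
    · simp only [ne_eq, hp, not_false_eq_true, true_and]
      exact gaussianSample_inner_tail hη hp
  have b3 : ∀ i : Fin n, (gaussianSample n d).real
      {x | √d / 4 ≤ |∑ i ∈ {i}, inner ℝ (x i) (b₁ + b₂)|} ≤ 2 * e := fun i => by
    refine (gaussianSample_abs_sum_inner_tail (b₁ + b₂) {i} (s := √d / 8) (by positivity)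
      _).trans ?_
    gcongr
    apply hexp
    rw [hDp, Finset.card_singleton]
    refine le_of_eq ?_
    push_cast
    linear_combination -(1 / 64) * hsd2
  have b4 : (gaussianSample n d).real
      {x | 2 * √(d * n) ≤ |∑ i ∈ G, inner ℝ (x i) (b₁ - b₂)|} ≤ 2 * e := by
    refine (gaussianSample_abs_sum_inner_tail (b₁ - b₂) G (s := √d / √n) (by positivity)
      _).trans ?_
    gcongr
    apply hexp
    have h1 : (√(d : ℝ) / √n) ^ 2 * G.card ≤ (√(d : ℝ) / √n) ^ 2 * n := by gcongr
    rw [hD, hdn]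
    linarith
  -- Applied to u = D ± eₖ, where ‖u‖² ≤ 2 + 1 + 2 · 3/2 = 6. The regime d ≤ n keeps s‖u‖² within
  -- 1/4.
  have b5 : ∀ u : E, u ≠ 0 → ‖u‖ ^ 2 ≤ 6 → d ≤ n → (gaussianSample n d).real
      {x | 8 * √(d * n) ≤ |∑ i ∈ G, (inner ℝ (x i) u ^ 2 - ‖u‖ ^ 2)|} ≤ 2 * e := by
    intro u hu hu6 hle
    have hle' : √(d : ℝ) / √n ≤ 1 := by
      rw [div_le_one hsn]
      exact Real.sqrt_le_sqrt (by exact_mod_cast hle)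
    refine (gaussianSample_abs_sum_inner_sq_tail hu G (s := √d / √n / 24) (by positivity) ?_
      _).trans ?_
    · calc √(d : ℝ) / √n / 24 * ‖u‖ ^ 2 ≤ 1 / 24 * 6 := by gcongr
        _ = _ := by norm_num
    · gcongr
      apply hexp
      have h1 : 2 * (√(d : ℝ) / √n / 24) ^ 2 * (‖u‖ ^ 2) ^ 2 * G.card ≤
          2 * (√(d : ℝ) / √n / 24) ^ 2 * 6 ^ 2 * n := by gcongr
      rw [hdn]
      have h2 : 2 * (√(d : ℝ) / √n / 24) ^ 2 * 6 ^ 2 * n = d / 8 := by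
        linear_combination (1 / 8) * hsq2
      have h3 : -(√(d : ℝ) / √n / 24) * (8 * (√d * √n)) = -d / 3 := by
        linear_combination -(1 / 3) * hsq
      linarith
  have hDn : ‖b₁ - b₂‖ ≤ 3 / 2 := by
    apply (pow_le_pow_iff_left₀ (norm_nonneg _) (by norm_num) two_ne_zero).1
    rw [hD]; norm_num
  have hDn' : 1 < ‖b₁ - b₂‖ := by
    apply (pow_lt_pow_iff_left₀ (by norm_num) (norm_nonneg _) two_ne_zero).1
    rw [hD]; norm_num
  have hsingle : ∀ k : Fin d, ‖(EuclideanSpace.single k 1 : E)‖ = 1 := fun k => by simp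
  have hcross : ∀ k : Fin d, |inner ℝ (b₁ - b₂) (EuclideanSpace.single k 1 : E)| ≤ 3 / 2 :=
    fun k => (abs_real_inner_le_norm _ _).trans (by rw [hsingle, mul_one]; exact hDn)
  have b6 : ∀ k : Fin d, (gaussianSample n d).real {x | d ≤ n ∧ 8 * √(d * n) ≤ |∑ i ∈ G,
      (inner ℝ (x i) (b₁ - b₂ + EuclideanSpace.single k 1) ^ 2 -
        ‖b₁ - b₂ + EuclideanSpace.single k 1‖ ^ 2)|} ≤ if d ≤ n then 2 * e else 0 := by
    intro k
    split_ifs with hle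
    · simp only [hle, true_and]
      refine b5 _ (fun h0 => ?_) ?_ hle
      · have := congrArg norm (eq_neg_of_add_eq_zero_left h0)
        rw [norm_neg, hsingle] at this
        linarith
      · rw [norm_add_sq_real, hD, hsingle]
        linarith [(abs_le.1 (hcross k)).2]
    · simp only [hle, false_and]
      exact (measureReal_empty).le
  have b7 : ∀ k : Fin d, (gaussianSample n d).real {x | d ≤ n ∧ 8 * √(d * n) ≤ |∑ i ∈ G,
      (inner ℝ (x i) (b₁ - b₂ - EuclideanSpace.single k 1) ^ 2 -
        ‖b₁ - b₂ - EuclideanSpace.single k 1‖ ^ 2)|} ≤ if d ≤ n then 2 * e else 0 := by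
    intro k
    split_ifs with hle
    · simp only [hle, true_and]
      refine b5 _ (fun h0 => ?_) ?_ hle
      · have := congrArg norm (sub_eq_zero.1 h0)
        rw [hsingle] at this
        linarith
      · rw [norm_sub_sq_real, hD, hsingle]
        linarith [(abs_le.1 (hcross k)).1]
    · simp only [hle, false_and]
      exact (measureReal_empty).le
  have b8 : (gaussianSample n d).real {x | n ≤ d ∧
      2 * d ≤ |∑ i ∈ G, (inner ℝ (x i) (b₁ - b₂) ^ 2 - ‖b₁ - b₂‖ ^ 2)|} ≤ 2 * e := by
    by_cases hle : n ≤ d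
    · simp only [hle, true_and]
      refine (gaussianSample_abs_sum_inner_sq_tail (fun h0 => ?_) G (s := 1 / 8) (by norm_num) ?_
        _).trans ?_
      · rw [h0, norm_zero] at hDn'
        linarith
      · rw [hD]; norm_num
      · gcongr
        apply hexp
        have hle' : (n : ℝ) ≤ d := by exact_mod_cast hle
        rw [hD]
        linarith
    · simp only [hle, false_and]
      exact (measureReal_empty).le.trans (by positivity)
  -- Coordinates are needed only for d ≤ n, so their union bound costs a factor n rather than d.
  have hdsum : ∑ _k : Fin d, (if d ≤ n then 2 * e else 0) ≤ n * (2 * e) := by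
    rw [Finset.sum_const, Finset.card_univ, Fintype.card_fin, nsmul_eq_mul]
    split_ifs with hle
    · have : (d : ℝ) ≤ n := by exact_mod_cast hle
      gcongr
    · rw [mul_zero]; positivity
  have c1 := (measureReal_iUnion_fintype_le (μ := gaussianSample n d) _).trans
    (Finset.sum_le_sum fun i _ => b1 i)
  have c2 := (measureReal_iUnion_fintype_le (μ := gaussianSample n d) _).trans
    (Finset.sum_le_sum fun p _ => b2 p)
  have c3 := (measureReal_iUnion_fintype_le (μ := gaussianSample n d) _).trans
    (Finset.sum_le_sum fun i _ => b3 i)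
  have c6 := ((measureReal_iUnion_fintype_le (μ := gaussianSample n d) _).trans
    (Finset.sum_le_sum fun k _ => b6 k)).trans hdsum
  have c7 := ((measureReal_iUnion_fintype_le (μ := gaussianSample n d) _).trans
    (Finset.sum_le_sum fun k _ => b7 k)).trans hdsum
  simp only [Finset.sum_const, Finset.card_univ, Fintype.card_fin, nsmul_eq_mul,
    Fintype.card_prod, Nat.cast_mul] at c1 c2 c3
  have hU := measureReal_mono (μ := gaussianSample n d) (not_isTypical_subset η G hD)
    (measure_ne_top _ _)
  refine hU.trans ((measureReal_union_le _ _).trans ((add_le_add ((measureReal_union_le _ _).trans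
    (add_le_add ((measureReal_union_le _ _).trans (add_le_add ((measureReal_union_le _ _).trans
    (add_le_add ((measureReal_union_le _ _).trans (add_le_add ((measureReal_union_le _ _).trans
    (add_le_add c1 c2)) c3)) b4)) c6)) c7)) b8).trans ?_))
  have e1 : (n : ℝ) * e ≤ n ^ 2 * e := by gcongr; nlinarith
  have e2 : e ≤ n ^ 2 * e := le_mul_of_one_le_left he0.le (one_le_pow₀ hn1)
  linarith

theorem sq_mul_exp_le {N c : ℝ} (h : N * Real.exp (-c) < 1) (hN : 0 ≤ N) :
    N ^ 2 * Real.exp (-(2 * c)) ≤ N * Real.exp (-c) := by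
  have h1 : Real.exp (-(2 * c)) = Real.exp (-c) ^ 2 := by
    rw [← Real.exp_nat_mul]; congr 1; push_cast; ring
  have h0 : 0 ≤ N * Real.exp (-c) := by positivity
  rw [h1, ← mul_pow]
  nlinarith

/-- By independence the directions and the sample have a product law, so the bound for fixed
directions passes to random ones of any distribution. -/
theorem measure_not_isTypical_le (hn : 0 < n) {η : ℝ} (hη : 0 ≤ η) (hη1 : η ≤ 1 / 4)
    (G : Finset (Fin n)) {Ω : Type*} [MeasurableSpace Ω] {P : Measure Ω} [IsProbabilityMeasure P]
    {X : Fin n → Ω → E} {b₁ b₂ : Ω → E} (hX : ∀ i, Measurable (X i))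
    (hlaw : ∀ i, HasLaw (X i) (stdGaussian E) P) (hind : iIndepFun X P)
    (hb₁ : Measurable b₁) (hb₂ : Measurable b₂)
    (hXb : IndepFun (fun ω i => X i ω) (fun ω => (b₁ ω, b₂ ω)) P)
    (hb : ∀ᵐ ω ∂P, ‖b₁ ω‖ = 1 ∧ ‖b₂ ω‖ = 1 ∧ inner ℝ (b₁ ω) (b₂ ω) = 0) :
    P {ω | ¬ IsTypical η G (b₁ ω) (b₂ ω) (fun i => X i ω)} ≤
      ENNReal.ofReal (14 * (n : ℝ) ^ 2 * Real.exp (-(η ^ 2 / 4) * d)) := by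
  have hXm : Measurable (fun ω i => X i ω) := measurable_pi_lambda _ hX
  have hbm : Measurable (fun ω => (b₁ ω, b₂ ω)) := hb₁.prodMk hb₂
  have hmapX : P.map (fun ω i => X i ω) = gaussianSample n d := by
    rw [(iIndepFun_iff_map_fun_eq_pi_map (fun i => (hX i).aemeasurable)).1 hind, gaussianSample]
    congr 1
    ext1 i
    exact (hlaw i).map_eq
  have hpair : P.map (fun ω => ((b₁ ω, b₂ ω), fun i => X i ω)) =
      (P.map (fun ω => (b₁ ω, b₂ ω))).prod (gaussianSample n d) := by
    rw [← hmapX]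
    exact (indepFun_iff_map_prod_eq_prod_map_map hbm.aemeasurable hXm.aemeasurable).1 hXb.symm
  have hmeas := (measurableSet_isTypical (n := n) (d := d) η G).compl
  have : IsProbabilityMeasure (P.map (fun ω => (b₁ ω, b₂ ω))) :=
    Measure.isProbabilityMeasure_map hbm.aemeasurable
  have hb' : ∀ᵐ p ∂(P.map (fun ω => (b₁ ω, b₂ ω))),
      ‖p.1‖ = 1 ∧ ‖p.2‖ = 1 ∧ inner ℝ p.1 p.2 = (0 : ℝ) := by
    rw [ae_map_iff hbm.aemeasurable]
    · exact hb
    · measurability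
  have key := measure_prod_le_of_ae_le (ν := gaussianSample n d) hmeas
    (c := ENNReal.ofReal (14 * (n : ℝ) ^ 2 * Real.exp (-(η ^ 2 / 4) * d))) (by
      filter_upwards [hb'] with p hp
      rw [← ENNReal.ofReal_toReal (measure_ne_top (gaussianSample n d) _)]
      exact ENNReal.ofReal_le_ofReal
        (gaussianSample_not_isTypical_le hn hη hη1 G hp.1 hp.2.1 hp.2.2))
  rw [← hpair, Measure.map_apply (hbm.prodMk hXm) hmeas] at key
  exact key

end GaussianSample

/-! ### The main theorem. -/

theorem theorem2 :
    -- running time, for all inputs: `T(f)` plus a quasilinear number of steps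
    (∃ c C : ℝ, 0 < c ∧ 0 < C ∧ ∀ n d m : ℕ, 0 < n → 0 < d →
      ∀ (f : (Fin n → EuclideanSpace ℝ (Fin d)) → ℝ → EuclideanSpace ℝ (Fin d))
        (T : (Fin n → EuclideanSpace ℝ (Fin d)) → ℝ → ℕ)
        (Y : Fin n → EuclideanSpace ℝ (Fin d)) (s : ℝ),
        (T Y s : ℝ) + c * ((n : ℝ) * d) ≤ reductionTime f T m Y s ∧
        (reductionTime f T m Y s : ℝ) ≤
          T Y s + C * ((n : ℝ) * d) * (1 + Real.log ((n : ℝ) * d))) ∧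
    -- correctness on the corrupted samples, with very high probability
    (∀ ε : ℝ, 0 < ε → ε < 1 / 2 → ∃ K : ℝ, 0 < K ∧ ∀ τ : ℝ, 0 ≤ τ →
      ∃ (N : ℕ) (c C : ℝ), 0 < c ∧ 0 < C ∧ ∀ n d : ℕ, N ≤ n →
      ∀ (f : (Fin n → EuclideanSpace ℝ (Fin d)) → ℝ → EuclideanSpace ℝ (Fin d))
        (T : (Fin n → EuclideanSpace ℝ (Fin d)) → ℝ → ℕ),
        IsStrongRobustAggregator ε τ f →
      ∀ (S₁ S₂ : Finset (Fin n)) (l : Fin n → ℝ), IsPlacement d ε S₁ S₂ l →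
      ∀ {Ω : Type*} [MeasurableSpace Ω] (P : Measure Ω) [IsProbabilityMeasure P]
        (X : Fin n → Ω → EuclideanSpace ℝ (Fin d)) (b₁ b₂ : Ω → EuclideanSpace ℝ (Fin d)),
        (∀ i, Measurable (X i)) →
        (∀ i, HasLaw (X i) (stdGaussian (EuclideanSpace ℝ (Fin d))) P) →
        iIndepFun X P →
        Measurable b₁ → Measurable b₂ →
        IndepFun (fun ω i => X i ω) (fun ω => (b₁ ω, b₂ ω)) P →
        (∀ᵐ ω ∂P, ‖b₁ ω‖ = 1 ∧ ‖b₂ ω‖ = 1 ∧ inner ℝ (b₁ ω) (b₂ ω) = 0) →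
      ∀ δ : ℝ, 2 < δ →
        P {ω | ¬ (
          let Y' := corrupted S₁ S₂ l (b₁ ω) (b₂ ω) (fun i => X i ω)
          let w := reductionOutput f T (S₁.card + S₂.card) Y' ‖sampleCov (fun i => X i ω)‖
          (w = b₁ ω - b₂ ω ∨ w = b₂ ω - b₁ ω) ∧
          ∀ v, IsMaxVarianceDirection Y' v →
            InnerProductGeometry.angle w v ≤ Real.arccos √(1 - K * (δ ^ 2 / n)) ∨
            InnerProductGeometry.angle w (-v) ≤ Real.arccos √(1 - K * (δ ^ 2 / n)))}
          ≤ ENNReal.ofReal (2 * Real.exp (-δ ^ 2 / 2) + C * n * Real.exp (-c * d))) := by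
  refine ⟨⟨1, 60, one_pos, by norm_num, fun n d m hn hd f T Y s => ?_⟩, fun ε hε hε1 => ?_⟩
  · rw [one_mul]
    exact reductionTime_bounds m hn hd f T Y s
  refine ⟨144 / ε ^ 4, by positivity, fun τ hτ => ?_⟩
  have hη := resolution_pos hε hτ
  have hη1 : resolution ε τ ≤ 1 / 4 := (resolution_le hτ).trans (by nlinarith)
  -- `N` ensures ηn ≥ 2. The rate is half the tail exponent η²/4, which pays for replacing n² by n.
  refine ⟨⌈2 / resolution ε τ⌉₊, resolution ε τ ^ 2 / 8, 14, by positivity, by norm_num, ?_⟩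
  intro n d hN f T hf S₁ S₂ l hp Ω _ P _ X b₁ b₂ hX hlaw hind hb₁ hb₂ hXb hb δ hδ
  have hn2 : 2 ≤ resolution ε τ * n := by
    have := (Nat.le_ceil _).trans (Nat.cast_le (α := ℝ).2 hN)
    rw [div_le_iff₀ hη] at this
    linarith
  have hn : 0 < n := by
    rcases Nat.eq_zero_or_pos n with h0 | h0
    · rw [h0] at hn2; norm_num at hn2
    · exact h0
  have he := Real.exp_pos (-δ ^ 2 / 2)
  -- In the first case the claimed bound exceeds 1. The second excludes d = 0 and allows
  -- `sq_mul_exp_le`.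
  rcases le_or_gt 1 ((n : ℝ) * Real.exp (-(resolution ε τ ^ 2 / 8 * d))) with h1 | h1
  · refine prob_le_one.trans ?_
    rw [← ENNReal.ofReal_one]
    refine ENNReal.ofReal_le_ofReal ?_
    rw [neg_mul]
    linarith
  have hd : 0 < d := by
    rcases Nat.eq_zero_or_pos d with h0 | h0
    · rw [h0] at h1
      have : (1 : ℝ) ≤ n := by exact_mod_cast hn
      norm_num at h1
      linarith
    · exact h0
  calc _ ≤ P {ω | ¬ IsTypical (resolution ε τ) (S₁ ∪ S₂)ᶜ (b₁ ω) (b₂ ω) (fun i => X i ω)} := by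
        -- Almost sure inclusion suffices, so the failure event itself need not be measurable.
        refine measure_mono_ae ?_
        filter_upwards [hb] with ω hω hbad htyp
        exact hbad (htyp.reduction_correct hε hε1 hτ hd hn2 hω.1 hω.2.1 hω.2.2 hp hf T hδ)
    _ ≤ _ := measure_not_isTypical_le hn hη.le hη1 _ hX hlaw hind hb₁ hb₂ hXb hb
    _ ≤ _ := by
        refine ENNReal.ofReal_le_ofReal ?_
        have h2 := sq_mul_exp_le h1 (Nat.cast_nonneg n)
        have h3 : -(resolution ε τ ^ 2 / 4) * d = -(2 * (resolution ε τ ^ 2 / 8 * d)) := by ring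
        rw [h3, neg_mul]
        linarith
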